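/- Let $k$ be an algebraically closed field of characteristic $0$, and let $A$, $B$, $V$ be $k$-vector spaces of dimensions $a$, $b$ and $4$. Let $f\ge 1$ be an integer, and assume $2b\ge 5a$ and $2a>5f$. Let $\mathcal M=\mathrm{Hom}(B,A\otimes V)$, an affine space with its Zariski topology. For $m\in\mathcal M$ let $m(1):B\otimes V\to A\otimes S^2V$ be the composition of $m\otimes 1_V$ with the product $A\otimes V\otimes V\to A\otimes S^2V$, and let $Z_m=\mathrm{Im}\,m(1)$. For a subspace $Z\subset A\otimes S^2V$ with quotient $F=(A\otimes S^2V)/Z$, let $Z^*\subset A\otimes V$ be the kernel of the map $A\otimes V\to \mathrm{Hom}(V,F)=V^\vee\otimes F$ sending $x\otimes y$ to $z\mapsto (x\otimes yz \bmod Z)$. Let $\mathcal W\subset\mathcal M$ be the locus of those $m$ for which $m(1)$ has corank (the minimum of the dimensions of kernel and cokernel) at least $f$, and let $\mathcal{PW}$ be the set of $m\in\mathcal W$ such that $Z_m$ has codimension exactly $f$ in $A\otimes S^2V$ and $Z_m^*$ has codimension $4f$ in $A\otimes V$. Then: 1. $\mathcal{PW}$ is open in $\mathcal W$, nonempty, irreducible,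 and of codimension $f(4b-10a+f)$ in $\mathcal M$ (that is, $\dim\mathcal{PW}=\dim\mathcal M-f(4b-10a+f)$). 2. The generic matrix $\mu$ of $\mathcal{PW}$ is the generic morphism $B\to Z^*$, where $Z$ is the generic codimension-$f$ subspace of $A\otimes S^2V$ (for which $Z^*$ has codimension $4f$), and the image of $\mu(1)$ is $Z$. Precisely: the Grassmannian $G$ of codimension-$f$ subspaces of $A\otimes S^2V$ is irreducible, and $\operatorname{codim}Z^*=4f$ for $Z$ in a dense open subset of $G$; the variety $Q\subset G\times\mathcal M$ of the pairs $(Z,m)$ with $\operatorname{codim} Z^*=4f$ and $m(B)\subset Z^*$ is irreducible; a property of pairs $(Z,m)$ holds for all $(Z_m,m)$ with $m$ in some dense open subset of $\mathcal{PW}$ if and only if it holds on some dense open subset of $Q$; one has $\mathrm{Im}\,m(1)=Z$ for all $(Z,m)$ in a dense open subset of $Q$; and for $Z$ in a dense open subset of $G$, all $m$ in a dense open subset of $\mathrm{Hom}(B,Z^*)$ satisfy $m\in\mathcal{PW}$ and $\mathrm{Im}\,m(1)=Z$. -/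

import Mathlib

open scoped TensorProduct

noncomputable section

namespace Steiner

universe u v w

section Zariski

variable (k : Type u) [Field k] (E : Type v) [AddCommGroup E] [Module k E]

/-- The algebra of polynomial functions on a vector space `E`: the subalgebra of `E → k`
generated by the linear forms. -/
def polyFun : Subalgebra k (E → k) :=
  Algebra.adjoin k (Set.range fun φ : Module.Dual k E => (φ : E → k))

/-- The common zeros in `E` of a set of functions. -/
def zeros (S : Set (E → k)) : Set E := {x | ∀ p ∈ S, p x = 0}

/-- The Zariski topology: the closed sets are the zero loci of sets of polynomial functions. -/
abbrev zariski : TopologicalSpace E :=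
  TopologicalSpace.ofClosed
    {C : Set E | ∃ S : Set (E → k), S ⊆ (polyFun k E : Set (E → k)) ∧ C = zeros k E S}
    ⟨{1}, by
      rintro _ rfl
      exact (polyFun k E).one_mem, by
      ext x
      simp [zeros]⟩
    (by
      intro 𝒞 h𝒞
      refine ⟨{p | p ∈ polyFun k E ∧ ∃ C ∈ 𝒞, ∀ x ∈ C, p x = 0}, fun p hp => hp.1, ?_⟩
      ext x
      constructor
      · rintro hx p ⟨-, C, hC, hp⟩
        exact hp x (hx C hC)
      · intro hx C hC
        obtain ⟨S, hS, rfl⟩ := h𝒞 hC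
        exact fun p hp => hx p ⟨hS hp, _, hC, fun y hy => hy p hp⟩)
    (by
      rintro _ ⟨S, hS, rfl⟩ _ ⟨T, hT, rfl⟩
      refine ⟨{r | ∃ p ∈ S, ∃ q ∈ T, r = p * q}, ?_, ?_⟩
      · rintro _ ⟨p, hp, q, hq, rfl⟩
        exact (polyFun k E).mul_mem (hS hp) (hT hq)
      · ext x
        constructor
        · rintro (hx | hx) _ ⟨p, hp, q, hq, rfl⟩
          · simp [hx p hp]
          · simp [hx q hq]
        · intro hx
          by_contra h
          simp only [zeros, Set.mem_union, Set.mem_ofPred_eq, not_or, not_forall] at h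
          obtain ⟨⟨p, hp, hpx⟩, q, hq, hqx⟩ := h
          exact mul_ne_zero hpx hqx (hx (p * q) ⟨p, hp, q, hq, rfl⟩))

/-- Spaces of linear maps carry the Zariski topology. -/
instance homTopology (F : Type w) [AddCommGroup F] [Module k F] : TopologicalSpace (E →ₗ[k] F) :=
  zariski k (E →ₗ[k] F)

end Zariski

section Generic

variable {X : Type v} [TopologicalSpace X]

/-- The property `P` holds for the generic element of `Y`: it holds on a non-empty relatively
open subset of `Y`. Used for irreducible `Y` only, where such a subset is dense. -/
def Generically (Y : Set X) (P : X → Prop) : Prop :=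
  ∃ U : Set X, IsOpen U ∧ (Y ∩ U).Nonempty ∧ ∀ x ∈ Y ∩ U, P x

/-- `Y` has codimension `c` in the ambient space: `X` and `Y` have finite dimension, with
`dim Y + c = dim X` (Krull dimensions of topological spaces). -/
def HasCodim (Y : Set X) (c : ℕ) : Prop :=
  ∃ d n : ℕ, topologicalKrullDim Y = d ∧ topologicalKrullDim X = n ∧ d + c = n

end Generic

section Grassmannian

variable (k : Type u) [Field k] (E : Type v) [AddCommGroup E] [Module k E] (f : ℕ)
  (N : Type w) [AddCommGroup N] [Module k N]

variable {k E f} in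
/-- The kernel of a surjective linear map `E → k^f`, as a point of the Grassmannian of
codimension `f` subspaces of `E`. -/
def kerGr (g : E →ₗ[k] (Fin f → k)) (hg : Function.Surjective g) : Module.Grassmannian k E f where
  toSubmodule := LinearMap.ker g
  finite_quotient := Module.Finite.equiv (g.quotKerEquivOfSurjective hg).symm
  projective_quotient := inferInstance
  rankAtStalk_eq p := by
    have : Module.Finite k (E ⧸ LinearMap.ker g) :=
      Module.Finite.equiv (g.quotKerEquivOfSurjective hg).symm
    rw [Module.rankAtStalk_eq_finrank_of_free, Pi.natCast_apply,
      (g.quotKerEquivOfSurjective hg).finrank_eq]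
    simp

/-- The Zariski topology of the Grassmannian of codimension `f` subspaces of `E`, as the quotient
of the (open) set of surjective linear maps `E → k^f` by the action of `GL_f`. -/
instance grTopology : TopologicalSpace (Module.Grassmannian k E f) :=
  TopologicalSpace.coinduced
    (fun g : {g : E →ₗ[k] (Fin f → k) // Function.Surjective g} => kerGr g.1 g.2)
    (TopologicalSpace.induced Subtype.val (zariski k (E →ₗ[k] (Fin f → k))))

/-- The product variety of the Grassmannian of codimension `f` subspaces of `E` and of the
affine space `N`; its points are the pairs `(sub, pt)`. -/
structure GrProd where
  /-- the subspace of codimension `f` -/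
  sub : Module.Grassmannian k E f
  /-- the point of the affine space -/
  pt : N

/-- The Zariski topology of `GrProd` (finer than the product topology), as the quotient of the set
of pairs `(g, n)` with `g : E → k^f` linear and surjective, by the action of `GL_f` on `g`. -/
instance grProdTopology : TopologicalSpace (GrProd k E f N) :=
  TopologicalSpace.coinduced
    (fun p : {p : (E →ₗ[k] (Fin f → k)) × N // Function.Surjective p.1} =>
      (⟨kerGr p.1.1 p.2, p.1.2⟩ : GrProd k E f N))
    (TopologicalSpace.induced Subtype.val (zariski k ((E →ₗ[k] (Fin f → k)) × N)))

end Grassmannian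

section LinearAlgebra

variable (k : Type u) [Field k]

/-- The codimension of a subspace. -/
def codim {E : Type*} [AddCommGroup E] [Module k E] (U : Submodule k E) : ℕ :=
  Module.finrank k (E ⧸ U)

/-- The corank of a linear map: the minimum of the dimensions of its kernel and cokernel. -/
def corank {E F : Type*} [AddCommGroup E] [Module k E] [AddCommGroup F] [Module k F]
    (φ : E →ₗ[k] F) : ℕ :=
  min (Module.finrank k (LinearMap.ker φ)) (codim k (LinearMap.range φ))

/-- The symmetric square `S²V`, the quotient of `V ⊗ V` by the tensors `v ⊗ w - w ⊗ v`. -/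
abbrev SymSq (V : Type*) [AddCommGroup V] [Module k V] : Type _ :=
  (V ⊗[k] V) ⧸ Submodule.span k {t : V ⊗[k] V | ∃ v w : V, t = v ⊗ₜ[k] w - w ⊗ₜ[k] v}

variable (A B V : Type*) [AddCommGroup A] [Module k A] [AddCommGroup B] [Module k B]
  [AddCommGroup V] [Module k V]

/-- The product `(A ⊗ V) ⊗ V → A ⊗ S²V`. -/
def prodMap : (A ⊗[k] V) ⊗[k] V →ₗ[k] A ⊗[k] SymSq k V :=
  (Submodule.mkQ _).lTensor A ∘ₗ (TensorProduct.assoc k A V V).toLinearMap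

variable {k A B V}

/-- The map `m(1) : B ⊗ V → A ⊗ S²V` induced by `m : B → A ⊗ V`. -/
def one (m : B →ₗ[k] A ⊗[k] V) : B ⊗[k] V →ₗ[k] A ⊗[k] SymSq k V :=
  prodMap k A V ∘ₗ m.rTensor V

/-- The subspace `Z_m = Im m(1)`. -/
def Zof (m : B →ₗ[k] A ⊗[k] V) : Submodule k (A ⊗[k] SymSq k V) :=
  LinearMap.range (one m)

/-- For a linear map `g : A ⊗ S²V → F`, the map `g* : A ⊗ V → Hom(V, F) = V^∨ ⊗ F` with
`g*(x ⊗ y)(z) = g(x ⊗ yz)`. -/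
def formStar {F : Type*} [AddCommGroup F] [Module k F] (g : A ⊗[k] SymSq k V →ₗ[k] F) :
    A ⊗[k] V →ₗ[k] (V →ₗ[k] F) :=
  TensorProduct.curry (g ∘ₗ prodMap k A V)

/-- For `Z ⊆ A ⊗ S²V` with quotient `F`, the kernel `Z*` of the map `A ⊗ V → Hom(V, F)` attached
to the projection `A ⊗ S²V → F`. -/
def Zstar (Z : Submodule k (A ⊗[k] SymSq k V)) : Submodule k (A ⊗[k] V) :=
  LinearMap.ker (formStar Z.mkQ)

variable (k A B V) (f : ℕ)

/-- The locus `𝒲` of the `m` such that `m(1)` has corank at least `f`. -/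
def locusW : Set (B →ₗ[k] A ⊗[k] V) :=
  {m | f ≤ corank k (one m)}

/-- The locus `𝒫𝒲` of the `m` in `𝒲` such that `Z_m` has codimension exactly `f` and `Z_m*` has
codimension `4f`. -/
def locusPW : Set (B →ₗ[k] A ⊗[k] V) :=
  {m | m ∈ locusW k A B V f ∧ codim k (Zof m) = f ∧
    codim k (Zstar (Zof m)) = 4 * f}

variable {k A V} in
/-- The space `Hom(B, Z*)`, as a subset of `Hom(B, A ⊗ V)`. -/
def homStar (Z : Submodule k (A ⊗[k] SymSq k V)) : Set (B →ₗ[k] A ⊗[k] V) :=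
  {m | LinearMap.range m ≤ Zstar Z}

/-- The variety of the pairs `(Z, m)` where `Z` is a codimension `f` subspace of `A ⊗ S²V` such
that `Z*` has codimension `4f`, and `m` is a morphism from `B` to `Z*`. -/
def locusQ : Set (GrProd k (A ⊗[k] SymSq k V) f (B →ₗ[k] A ⊗[k] V)) :=
  {p | codim k (Zstar p.sub.toSubmodule) = 4 * f ∧ p.pt ∈ homStar B p.sub.toSubmodule}

end LinearAlgebra

end Steiner

end

/-! Replace a subspace `Z` of codimension `f` by a surjection `g : A ⊗ S²V → k^f` with kernel `Z`.
Then `Z*` is the kernel of `g*`, it has codimension `4f` exactly when `g*` is surjective, and `Z_m ⊆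
Z` becomes the equation `g* ∘ m = 0`, which is linear in `m` (`Zof_le_ker`). Since `4b ≥ 10a`, the
corank of `m(1)` is the codimension of `Z_m`.

Hence `𝒬` is fibred over the `Z` with `g*` surjective in vector spaces `Hom(B, ker g*)` of constant
dimension, so it is irreducible: a projection onto `ker g*` along a fixed complement depends
regularly on `g` (`projKer`, `isPreirreducible_pairs`). The pairs with `m(1)` of rank at least `10a
- f` form an open subset of `𝒬`, on which `Z = Z_m`, and `m ↦ (Z_m, m)` identifies `𝒫𝒲` with it.

The way back is `exists_local_form`: near a point of `𝒫𝒲`, `Z_m` contains the kernel of a map `γ m`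
that depends regularly on `m`, with equality wherever `codim Z_m ≥ f`. This makes `𝒫𝒲` open in `𝒲`,
transfers generic properties between `𝒫𝒲` and `𝒬`, and yields charts of `𝒫𝒲` on open sets of `Hom(Z,
k^f) × Hom(B, Z*)`, of dimension `f(10a - f) + b(4a - 4f)`; this gives the codimension.

All of this needs one point of `𝒫𝒲`. It is a direct sum of small explicit blocks with integer
coefficients (`hasDatum`, `exists_of_hasDatum`). -/

noncomputable section

namespace Steiner

/-! ### Regular functions and regular maps on subsets of vector spaces -/

section Regular

variable {k : Type*} [Field k]
variable {E : Type*} [AddCommGroup E] [Module k E]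
variable {F : Type*} [AddCommGroup F] [Module k F]
variable {G : Type*} [AddCommGroup G] [Module k G]
variable {H : Type*} [AddCommGroup H] [Module k H]

variable (k) in
/-- The given topology of the vector space `E` is the Zariski topology. -/
class ZariskiSpace (E : Type*) [AddCommGroup E] [Module k E] [t : TopologicalSpace E] : Prop where
  eq_zariski : t = zariski k E

instance zariskiSpace_hom : ZariskiSpace k (E →ₗ[k] F) := ⟨rfl⟩

theorem isClosed_iff_zeros [t : TopologicalSpace E] [h : ZariskiSpace k E] {C : Set E} :
    IsClosed C ↔ ∃ S : Set (E → k), S ⊆ (polyFun k E : Set (E → k)) ∧ C = zeros k E S := by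
  obtain rfl := h.eq_zariski
  rw [← @isOpen_compl_iff _ _ (zariski k E)]
  change Cᶜᶜ ∈ _ ↔ _
  rw [compl_compl]
  rfl

theorem dual_mem_polyFun (φ : Module.Dual k E) : (φ : E → k) ∈ polyFun k E :=
  Algebra.subset_adjoin ⟨φ, rfl⟩

theorem isOpen_setOf_ne_zero [TopologicalSpace E] [ZariskiSpace k E] {p : E → k}
    (hp : p ∈ polyFun k E) : IsOpen {x | p x ≠ 0} := by
  rw [← isClosed_compl_iff, isClosed_iff_zeros (k := k)]
  refine ⟨{p}, by simpa using hp, ?_⟩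
  ext x
  simp [zeros]

theorem exists_polyFun_of_isOpen [TopologicalSpace E] [ZariskiSpace k E] {U : Set E}
    (hU : IsOpen U) {x : E} (hx : x ∈ U) :
    ∃ p ∈ polyFun k E, p x ≠ 0 ∧ ∀ y, p y ≠ 0 → y ∈ U := by
  obtain ⟨S, hS, hUS⟩ := (isClosed_iff_zeros (k := k)).1 hU.isClosed_compl
  have hx' : x ∉ zeros k E S := by
    rw [← hUS]
    simpa using hx
  simp only [zeros, Set.mem_ofPred_eq, not_forall] at hx'
  obtain ⟨p, hp, hpx⟩ := hx'
  refine ⟨p, hS hp, hpx, fun y hy => ?_⟩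
  by_contra h
  have : y ∈ zeros k E S := hUS ▸ h
  exact hy (this p hp)

/-- The functions that agree on `X` with a quotient of polynomial functions whose denominator has
no zero in `X`. -/
def regFun (X : Set E) : Subalgebra k (E → k) where
  carrier := {r | ∃ p ∈ polyFun k E, ∃ q ∈ polyFun k E, ∀ x ∈ X, q x ≠ 0 ∧ r x = p x / q x}
  mul_mem' := by
    rintro r r' ⟨p, hp, q, hq, h⟩ ⟨p', hp', q', hq', h'⟩
    refine ⟨p * p', mul_mem hp hp', q * q', mul_mem hq hq', fun x hx => ⟨?_, ?_⟩⟩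
    · exact mul_ne_zero (h x hx).1 (h' x hx).1
    · simp [(h x hx).2, (h' x hx).2, div_mul_div_comm]
  add_mem' := by
    rintro r r' ⟨p, hp, q, hq, h⟩ ⟨p', hp', q', hq', h'⟩
    refine ⟨p * q' + q * p', add_mem (mul_mem hp hq') (mul_mem hq hp'), q * q', mul_mem hq hq',
      fun x hx => ⟨mul_ne_zero (h x hx).1 (h' x hx).1, ?_⟩⟩
    simp [(h x hx).2, (h' x hx).2, div_add_div _ _ (h x hx).1 (h' x hx).1]
  algebraMap_mem' c :=
    ⟨algebraMap k _ c, Subalgebra.algebraMap_mem _ c, 1, one_mem _, fun x _ => by simp⟩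

theorem polyFun_le_regFun (X : Set E) : polyFun k E ≤ regFun X :=
  fun p hp => ⟨p, hp, 1, one_mem _, fun x _ => by simp⟩

theorem regFun_inv {X : Set E} {r : E → k} (hr : r ∈ regFun X) (h0 : ∀ x ∈ X, r x ≠ 0) :
    r⁻¹ ∈ regFun X := by
  obtain ⟨p, hp, q, hq, h⟩ := hr
  refine ⟨q, hq, p, hp, fun x hx => ⟨fun h1 => h0 x hx ?_, ?_⟩⟩
  · rw [(h x hx).2, h1, zero_div]
  · simp [(h x hx).2]

theorem regFun_congr {X : Set E} {r r' : E → k} (hr : r ∈ regFun X) (h : ∀ x ∈ X, r' x = r x) :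
    r' ∈ regFun X := by
  obtain ⟨p, hp, q, hq, h'⟩ := hr
  exact ⟨p, hp, q, hq, fun x hx => ⟨(h' x hx).1, (h x hx).trans (h' x hx).2⟩⟩

theorem regFun_anti {X Y : Set E} (h : X ⊆ Y) : regFun (k := k) Y ≤ regFun X := by
  rintro r ⟨p, hp, q, hq, h'⟩
  exact ⟨p, hp, q, hq, fun x hx => h' x (h hx)⟩

variable (k) in
/-- A map between vector spaces is regular on `X` if its composition with every linear form is. -/
def RegularOn (f : E → F) (X : Set E) : Prop :=
  ∀ φ : Module.Dual k F, (fun x => φ (f x)) ∈ regFun X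

namespace RegularOn

variable {X Y : Set E} {f f' : E → F} {g : E → G}

theorem mono (hf : RegularOn k f Y) (h : X ⊆ Y) : RegularOn k f X :=
  fun φ => regFun_anti h (hf φ)

theorem const (c : F) (X : Set E) : RegularOn k (fun _ => c) X :=
  fun φ => Subalgebra.algebraMap_mem (regFun X) (φ c)

theorem linear (T : E →ₗ[k] F) (X : Set E) : RegularOn k (fun x => T x) X :=
  fun φ => polyFun_le_regFun X (dual_mem_polyFun (φ ∘ₗ T))

theorem map (hf : RegularOn k f X) (T : F →ₗ[k] G) : RegularOn k (fun x => T (f x)) X :=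
  fun φ => hf (φ ∘ₗ T)

theorem add (hf : RegularOn k f X) (hf' : RegularOn k f' X) :
    RegularOn k (fun x => f x + f' x) X := fun φ => by
  simp only [map_add]
  exact add_mem (hf φ) (hf' φ)

theorem sub (hf : RegularOn k f X) (hf' : RegularOn k f' X) :
    RegularOn k (fun x => f x - f' x) X := fun φ => by
  simp only [map_sub]
  exact sub_mem (hf φ) (hf' φ)

theorem prodMk (hf : RegularOn k f X) (hg : RegularOn k g X) :
    RegularOn k (fun x => (f x, g x)) X := fun φ => by
  refine regFun_congr (add_mem (hf (φ ∘ₗ LinearMap.inl k F G)) (hg (φ ∘ₗ LinearMap.inr k F G)))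
    fun x _ => ?_
  simp [← map_add]

theorem of_forall_basis {ι : Type*} [Fintype ι] (b : Module.Basis ι k F)
    (h : ∀ i, (fun x => b.repr (f x) i) ∈ regFun X) : RegularOn k f X := fun φ => by
  have : (fun x => φ (f x)) = ∑ i, φ (b i) • fun x => b.repr (f x) i := by
    ext x
    conv_lhs => rw [← b.sum_repr (f x)]
    simp [-Module.Basis.sum_repr, mul_comm]
  rw [this]
  exact sum_mem fun i _ => Subalgebra.smul_mem _ (h i) _

theorem bilin [FiniteDimensional k F] (β : F →ₗ[k] G →ₗ[k] H) (hf : RegularOn k f X)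
    (hg : RegularOn k g X) : RegularOn k (fun x => β (f x) (g x)) X := fun φ => by
  let b := Module.finBasis k F
  have : (fun x => φ (β (f x) (g x))) =
      ∑ i, (fun x => b.coord i (f x)) * fun x => (φ ∘ₗ β (b i)) (g x) := by
    ext x
    conv_lhs => rw [← b.sum_repr (f x)]
    simp [-Module.Basis.sum_repr]
  rw [this]
  exact sum_mem fun i _ => mul_mem (hf _) (hg _)

theorem polyFun_comp (hf : RegularOn k f X) {p : F → k} (hp : p ∈ polyFun k F) :
    (fun x => p (f x)) ∈ regFun X := by
  induction hp using Algebra.adjoin_induction with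
  | mem p hp =>
    obtain ⟨φ, rfl⟩ := hp
    exact hf φ
  | algebraMap c => exact Subalgebra.algebraMap_mem (regFun X) c
  | add p q _ _ hp hq => exact add_mem hp hq
  | mul p q _ _ hp hq => exact mul_mem hp hq

theorem continuousOn [TopologicalSpace E] [ZariskiSpace k E] [TopologicalSpace F]
    [ZariskiSpace k F] (hf : RegularOn k f X) : ContinuousOn f X := by
  rw [continuousOn_iff]
  intro x hx U hU hxU
  obtain ⟨p, hp, hpx, hpU⟩ := exists_polyFun_of_isOpen (k := k) hU hxU
  obtain ⟨r, hr, q, hq, h⟩ := hf.polyFun_comp hp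
  beta_reduce at h
  -- On `X` the pullback of `p` is `r / q` with `q` nowhere zero, so it vanishes exactly where the
  -- numerator `r` does.
  refine ⟨{y | r y ≠ 0}, isOpen_setOf_ne_zero hr, fun h0 => hpx ?_, ?_⟩
  · rw [(h x hx).2, h0, zero_div]
  · rintro y ⟨hy, hyX⟩
    refine hpU _ ?_
    rw [(h y hyX).2]
    exact div_ne_zero hy (h y hyX).1

end RegularOn

section Inverse

variable [FiniteDimensional k G]

theorem det_mem_regFun {X : Set E} {L : E → Module.End k G} (hL : RegularOn k L X) :
    (fun x => LinearMap.det (L x)) ∈ regFun X := by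
  classical
  let b := Module.finBasis k G
  have h : (fun x => LinearMap.det (L x)) =
      ∑ σ : Equiv.Perm (Fin (Module.finrank k G)),
        ((Equiv.Perm.sign σ : ℤ) : E → k) * ∏ i, fun x => b.coord (σ i) (L x (b i)) := by
    ext x
    rw [← LinearMap.det_toMatrix b, Matrix.det_apply']
    simp [LinearMap.toMatrix_apply]
  rw [h]
  refine sum_mem fun σ _ => mul_mem (intCast_mem _ _) (prod_mem fun i _ => ?_)
  exact hL (b.coord (σ i) ∘ₗ LinearMap.applyₗ (b i))

/-- Cramer's rule over the ring `regFun X`: the matrix entries of `L` lie there, and so does the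
inverse of the determinant, which has no zero on `X`. Only the values on `X` matter, so the default
value of `Ring.inverse` elsewhere is harmless. -/
theorem RegularOn.inverse {X : Set E} {L : E → Module.End k G} (hL : RegularOn k L X)
    (hX : ∀ x ∈ X, IsUnit (L x)) : RegularOn k (fun x => Ring.inverse (L x)) X := by
  classical
  let b := Module.finBasis k G
  let M : Matrix _ _ (regFun (k := k) X) := fun i j =>
    ⟨fun x => b.coord i (L x (b j)), hL (b.coord i ∘ₗ LinearMap.applyₗ (b j))⟩
  let ev (x : E) : regFun (k := k) X →+* k :=
    (Pi.evalRingHom (fun _ : E => k) x).comp (regFun X).val.toRingHom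
  have hM (x : E) : (ev x).mapMatrix M = LinearMap.toMatrix b b (L x) := by
    ext i j
    rw [LinearMap.toMatrix_apply]
    rfl
  have hdet (x : E) : ev x M.det = LinearMap.det (L x) := by
    rw [RingHom.map_det, hM, LinearMap.det_toMatrix]
  have hadj (x : E) : (ev x).mapMatrix M.adjugate = (LinearMap.toMatrix b b (L x)).adjugate := by
    rw [RingHom.map_adjugate, hM]
  refine RegularOn.of_forall_basis (b.linearMap b) fun ij => ?_
  have h1 : (M.det : E → k)⁻¹ * (M.adjugate ij.1 ij.2 : E → k) ∈ regFun X := by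
    refine mul_mem (regFun_inv M.det.2 fun x hx h0 => ?_) (M.adjugate ij.1 ij.2).2
    have := LinearMap.isUnit_det _ (hX x hx)
    rw [← hdet x] at this
    exact this.ne_zero h0
  refine regFun_congr h1 fun x hx => ?_
  have e1 : LinearMap.toMatrix b b (Ring.inverse (L x)) = (LinearMap.toMatrix b b (L x))⁻¹ := by
    refine (Matrix.inv_eq_right_inv ?_).symm
    rw [← LinearMap.toMatrix_mul, Ring.mul_inverse_cancel _ (hX x hx), LinearMap.toMatrix_one]
  have e2 : (b.linearMap b).repr (Ring.inverse (L x)) ij =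
      LinearMap.toMatrix b b (Ring.inverse (L x)) ij.1 ij.2 := by
    rfl
  rw [e2, e1, Matrix.inv_def, Matrix.smul_apply, ← hadj, LinearMap.det_toMatrix, ← hdet]
  simp [ev]

end Inverse

end Regular

/-! ### Open conditions: invertibility, rank at least `r`, surjectivity -/

section Open

variable {k : Type*} [Field k]
variable {E : Type*} [AddCommGroup E] [Module k E]
variable {F : Type*} [AddCommGroup F] [Module k F]
variable {G : Type*} [AddCommGroup G] [Module k G]

theorem isOpen_setOf_regFun_ne_zero [TopologicalSpace E] [ZariskiSpace k E] {U : Set E}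
    (hU : IsOpen U) {r : E → k} (hr : r ∈ regFun U) : IsOpen {x | x ∈ U ∧ r x ≠ 0} := by
  obtain ⟨p, hp, q, -, h⟩ := hr
  have : {x | x ∈ U ∧ r x ≠ 0} = U ∩ {x | p x ≠ 0} := by
    ext x
    refine and_congr_right fun hx => ?_
    have h0 := (h x hx).1
    simp [(h x hx).2, h0]
  rw [this]
  exact hU.inter (isOpen_setOf_ne_zero hp)

/-- The locus of an open set where a regular family of endomorphisms is invertible is open. -/
theorem isOpen_setOf_isUnit [TopologicalSpace E] [ZariskiSpace k E] [FiniteDimensional k G]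
    {U : Set E} (hU : IsOpen U) {L : E → Module.End k G} (hL : RegularOn k L U) :
    IsOpen {x | x ∈ U ∧ IsUnit (L x)} := by
  simpa only [LinearMap.isUnit_iff_isUnit_det, isUnit_iff_ne_zero] using
    isOpen_setOf_regFun_ne_zero hU (det_mem_regFun hL)

/-- A linear map of rank at least `r` has an invertible `r × r` minor. -/
theorem exists_comp_comp_eq_id_of_le_finrank_range [FiniteDimensional k G] (T : F →ₗ[k] G) {r : ℕ}
    (h : r ≤ Module.finrank k (LinearMap.range T)) :
    ∃ (p : G →ₗ[k] (Fin r → k)) (c : (Fin r → k) →ₗ[k] F), p ∘ₗ T ∘ₗ c = LinearMap.id := by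
  obtain ⟨v, hv⟩ := exists_linearIndependent_of_le_finrank (R := k) h
  choose w hw using fun i => (v i).2
  let c := Fintype.linearCombination k w
  have hinj : LinearMap.ker (T ∘ₗ c) = ⊥ := by
    have h1 : LinearIndependent k fun i => (v i : G) :=
      hv.map' (LinearMap.range T).subtype (Submodule.ker_subtype _)
    have h2 : T ∘ₗ c = Fintype.linearCombination k fun i => (v i : G) := by
      refine LinearMap.ext fun x => ?_
      simp [c, Fintype.linearCombination_apply, hw]
    rw [h2, LinearMap.ker_eq_bot']
    intro x hx
    exact funext (Fintype.linearIndependent_iff.1 h1 x hx)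
  obtain ⟨p, hp⟩ := (T ∘ₗ c).exists_leftInverse_of_injective hinj
  exact ⟨p, c, hp⟩

theorem le_finrank_range_of_isUnit [FiniteDimensional k G] (T : F →ₗ[k] G) {r : ℕ}
    (p : G →ₗ[k] (Fin r → k)) (c : (Fin r → k) →ₗ[k] F)
    (h : IsUnit (p ∘ₗ T ∘ₗ c : Module.End k (Fin r → k))) :
    r ≤ Module.finrank k (LinearMap.range T) := by
  have h1 : LinearMap.range (p ∘ₗ T ∘ₗ c) = ⊤ :=
    LinearMap.range_eq_top.2 ((Module.End.isUnit_iff _).1 h).2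
  have h2 : (LinearMap.range T).map p = ⊤ := by
    refine top_unique (h1 ▸ ?_)
    rintro _ ⟨x, rfl⟩
    exact ⟨T (c x), ⟨_, rfl⟩, rfl⟩
  have := Submodule.finrank_map_le p (LinearMap.range T)
  rw [h2] at this
  simpa using this

/-- Linear maps of rank at least `r` form an open set. -/
theorem isOpen_setOf_le_finrank_range [TopologicalSpace E] [ZariskiSpace k E]
    [FiniteDimensional k F] [FiniteDimensional k G]
    {U : Set E} (hU : IsOpen U) {T : E → F →ₗ[k] G} (hT : RegularOn k T U) (r : ℕ) :
    IsOpen {x | x ∈ U ∧ r ≤ Module.finrank k (LinearMap.range (T x))} := by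
  rw [isOpen_iff_forall_mem_open]
  rintro x ⟨hxU, hx⟩
  obtain ⟨p, c, hpc⟩ := exists_comp_comp_eq_id_of_le_finrank_range (T x) hx
  refine ⟨{y | y ∈ U ∧ IsUnit (p ∘ₗ T y ∘ₗ c : Module.End k (Fin r → k))},
    fun y hy => ⟨hy.1, le_finrank_range_of_isUnit (T y) p c hy.2⟩, ?_, hxU, ?_⟩
  · refine isOpen_setOf_isUnit hU ?_
    exact hT.map ((LinearMap.compRight k p) ∘ₗ (LinearMap.lcomp k G c))
  · rw [hpc]
    exact isUnit_one

theorem surjective_iff_le_finrank_range [FiniteDimensional k G] (T : F →ₗ[k] G) :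
    Function.Surjective T ↔ Module.finrank k G ≤ Module.finrank k (LinearMap.range T) := by
  rw [← LinearMap.range_eq_top]
  refine ⟨fun h => by rw [h, finrank_top], fun h => ?_⟩
  exact Submodule.eq_top_of_finrank_eq (le_antisymm (Submodule.finrank_le _) h)

theorem isOpen_setOf_surjective [TopologicalSpace E] [ZariskiSpace k E]
    [FiniteDimensional k F] [FiniteDimensional k G]
    {U : Set E} (hU : IsOpen U) {T : E → F →ₗ[k] G} (hT : RegularOn k T U) :
    IsOpen {x | x ∈ U ∧ Function.Surjective (T x)} := by
  simpa only [surjective_iff_le_finrank_range] using isOpen_setOf_le_finrank_range hU hT _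

end Open

/-! ### Irreducibility by means of lines -/

section Irreducible

variable {k : Type*} [Field k]
variable {E : Type*} [AddCommGroup E] [Module k E]

theorem exists_polynomial_of_mem_polyFun {p : E → k} (hp : p ∈ polyFun k E) (x v : E) :
    ∃ P : Polynomial k, ∀ t, P.eval t = p (x + t • v) := by
  induction hp using Algebra.adjoin_induction with
  | mem p hp =>
    obtain ⟨φ, rfl⟩ := hp
    refine ⟨Polynomial.C (φ x) + Polynomial.C (φ v) * Polynomial.X, fun t => ?_⟩
    simp [mul_comm (φ v)]
  | algebraMap c => exact ⟨Polynomial.C c, fun t => by simp⟩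
  | add p q _ _ hp hq =>
    obtain ⟨P, hP⟩ := hp
    obtain ⟨Q, hQ⟩ := hq
    exact ⟨P + Q, fun t => by simp [hP, hQ]⟩
  | mul p q _ _ hp hq =>
    obtain ⟨P, hP⟩ := hp
    obtain ⟨Q, hQ⟩ := hq
    exact ⟨P * Q, fun t => by simp [hP, hQ]⟩

/-- Two nonempty open subsets of the line joining two points have a common point. -/
theorem exists_line_mem [Infinite k] [TopologicalSpace E] [ZariskiSpace k E] {U W : Set E}
    (hU : IsOpen U) (hW : IsOpen W) {x y : E} (hx : x ∈ U) (hy : y ∈ W) :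
    ∃ t : k, x + t • (y - x) ∈ U ∧ x + t • (y - x) ∈ W := by
  obtain ⟨p, hp, hpx, hpU⟩ := exists_polyFun_of_isOpen (k := k) hU hx
  obtain ⟨q, hq, hqy, hqW⟩ := exists_polyFun_of_isOpen (k := k) hW hy
  obtain ⟨P, hP⟩ := exists_polynomial_of_mem_polyFun hp x (y - x)
  obtain ⟨Q, hQ⟩ := exists_polynomial_of_mem_polyFun hq x (y - x)
  -- The parameter `0` gives `x` and the parameter `1` gives `y`, so neither restriction to the line
  -- is the zero polynomial; over an infinite field their product has a nonzero value.
  have hP0 : P ≠ 0 := by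
    rintro rfl
    exact hpx (by simpa using (hP 0).symm)
  have hQ0 : Q ≠ 0 := by
    rintro rfl
    exact hqy (by simpa using (hQ 1).symm)
  obtain ⟨t, ht⟩ := Polynomial.exists_eval_ne_zero_of_natDegree_lt_card (P * Q)
    (mul_ne_zero hP0 hQ0) ((Cardinal.natCast_lt_aleph0).trans_le (Cardinal.aleph0_le_mk k))
  rw [Polynomial.eval_mul] at ht
  exact ⟨t, hpU _ (hP t ▸ left_ne_zero_of_mul ht), hqW _ (hQ t ▸ right_ne_zero_of_mul ht)⟩

variable (k) in
/-- A subset of a vector space stable under affine combinations of two points is irreducible. -/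
theorem isPreirreducible_of_line_mem [Infinite k] [TopologicalSpace E] [ZariskiSpace k E]
    {S : Set E} (hS : ∀ x ∈ S, ∀ y ∈ S, ∀ t : k, x + t • (y - x) ∈ S) : IsPreirreducible S := by
  rintro U W hU hW ⟨x, hxS, hx⟩ ⟨y, hyS, hy⟩
  obtain ⟨t, ht⟩ := exists_line_mem (k := k) hU hW hx hy
  exact ⟨_, hS x hxS y hyS t, ht⟩

theorem isPreirreducible_inter_isOpen {X : Type*} [TopologicalSpace X] {S U : Set X}
    (hS : IsPreirreducible S) (hU : IsOpen U) : IsPreirreducible (S ∩ U) := by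
  rintro V W hV hW ⟨x, ⟨hxS, hxU⟩, hx⟩ ⟨y, ⟨hyS, hyU⟩, hy⟩
  obtain ⟨z, hz, ⟨hz1, hz2⟩, -, hz3⟩ := hS (U ∩ V) (U ∩ W) (hU.inter hV) (hU.inter hW)
    ⟨x, hxS, hxU, hx⟩ ⟨y, hyS, hyU, hy⟩
  exact ⟨z, ⟨hz, hz1⟩, hz2, hz3⟩

variable (k) in
theorem isPreirreducible_of_isOpen [Infinite k] [TopologicalSpace E] [ZariskiSpace k E]
    {U : Set E} (hU : IsOpen U) : IsPreirreducible U := by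
  simpa using isPreirreducible_inter_isOpen
    (isPreirreducible_of_line_mem k (S := (Set.univ : Set E)) (by simp)) hU

/-- A set is irreducible if any two of its points lie in a common irreducible subset. -/
theorem isPreirreducible_of_forall_pair {X : Type*} [TopologicalSpace X] {S : Set X}
    (h : ∀ x ∈ S, ∀ y ∈ S, ∃ T ⊆ S, IsPreirreducible T ∧ x ∈ T ∧ y ∈ T) :
    IsPreirreducible S := by
  rintro U W hU hW ⟨x, hxS, hx⟩ ⟨y, hyS, hy⟩
  obtain ⟨T, hTS, hT, hxT, hyT⟩ := h x hxS y hyS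
  obtain ⟨z, hz, hz'⟩ := hT U W hU hW ⟨x, hxT, hx⟩ ⟨y, hyT, hy⟩
  exact ⟨z, hTS hz, hz'⟩

end Irreducible

/-! ### Krull dimension of open subsets of a vector space -/

section Dimension

/-- Every irreducible closed set above a given `Z` meets each open set that `Z` meets, so the
coheight of `Z` can be computed in a neighbourhood of one of its points. -/
theorem topologicalKrullDim_le_of_forall_mem_open {X : Type*} [TopologicalSpace X] {d : ℕ}
    (h : ∀ x : X, ∃ U : Set X, IsOpen U ∧ x ∈ U ∧ topologicalKrullDim U ≤ d) :
    topologicalKrullDim X ≤ d := by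
  rw [topologicalKrullDim, Order.krullDim_eq_iSup_coheight]
  refine iSup_le fun Z => ?_
  obtain ⟨x, hx⟩ := Z.isIrreducible.nonempty
  obtain ⟨U, hU, hxU, hd⟩ := h x
  have he := hU.isOpenEmbedding_subtypeVal
  let Z' := (TopologicalSpace.IrreducibleCloseds.orderIsoOfIsOpenEmbedding _ he).symm
    ⟨Z, ⟨⟨x, hxU⟩, hx⟩⟩
  have hZ' : TopologicalSpace.IrreducibleCloseds.map _ he.continuous Z' = Z :=
    congrArg Subtype.val ((TopologicalSpace.IrreducibleCloseds.orderIsoOfIsOpenEmbedding _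
      he).apply_symm_apply ⟨Z, ⟨⟨x, hxU⟩, hx⟩⟩)
  rw [← hZ', he.coheight_map]
  exact (Order.coheight_le_krullDim Z').trans hd

variable {k : Type*} [Field k]
variable {E : Type*} [AddCommGroup E] [Module k E] [FiniteDimensional k E]

-- Coordinates present `polyFun k E` as a quotient of a polynomial ring in `dim E` variables.
variable (k E) in
theorem ringKrullDim_polyFun_le : ringKrullDim (polyFun k E) ≤ Module.finrank k E := by
  let b := Module.finBasis k E
  let φ : MvPolynomial (Fin (Module.finrank k E)) k →ₐ[k] polyFun k E :=
    MvPolynomial.aeval fun i => ⟨b.coord i, dual_mem_polyFun _⟩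
  have hφ : Function.Surjective φ := by
    have key : polyFun k E ≤ ((polyFun k E).val.comp φ).range := by
      refine Algebra.adjoin_le ?_
      rintro _ ⟨ψ, rfl⟩
      refine ⟨∑ i, MvPolynomial.C (ψ (b i)) * MvPolynomial.X i, ?_⟩
      ext x
      have : ψ x = ∑ i, ψ (b i) * b.repr x i := by
        conv_lhs => rw [← b.sum_repr x]
        simp [-Module.Basis.sum_repr, mul_comm]
      simp [φ, this, Algebra.algebraMap_eq_smul_one, ← MvPolynomial.algebraMap_eq]
    rintro ⟨p, hp⟩
    obtain ⟨P, hP⟩ := key hp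
    exact ⟨P, Subtype.ext hP⟩
  have := ringKrullDim_le_of_surjective φ.toRingHom hφ
  rw [MvPolynomial.ringKrullDim_of_isNoetherianRing] at this
  simpa using this

-- Vanishing ideals of irreducible closed sets are prime, and a closed set is recovered from its
-- ideal because it is a zero locus by definition. A chain of irreducible closed sets thus gives a
-- chain of primes; no Nullstellensatz is needed.
variable (k E) in
theorem topologicalKrullDim_le_finrank [TopologicalSpace E] [ZariskiSpace k E] :
    topologicalKrullDim E ≤ Module.finrank k E := by
  refine le_trans ?_ (ringKrullDim_polyFun_le k E)
  rw [topologicalKrullDim, ← Order.krullDim_orderDual]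
  let I (Z : TopologicalSpace.IrreducibleCloseds E) : Ideal (polyFun k E) :=
    { carrier := {p | ∀ x ∈ Z, (p : E → k) x = 0}
      add_mem' := fun hp hq x hx => by simp [hp x hx, hq x hx]
      zero_mem' := fun x _ => rfl
      smul_mem' := fun c p hp x hx => by simp [hp x hx] }
  have hI (Z) : (I Z).IsPrime := by
    refine ⟨?_, ?_⟩
    · rw [Ne, Ideal.eq_top_iff_one]
      obtain ⟨x, hx⟩ := Z.isIrreducible.nonempty
      intro h
      exact one_ne_zero (h x hx)
    · intro p q hpq
      by_contra! h
      obtain ⟨hp, hq⟩ := h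
      have hp' : ∃ x ∈ Z, (p : E → k) x ≠ 0 := by
        by_contra! h'
        exact hp h'
      have hq' : ∃ x ∈ Z, (q : E → k) x ≠ 0 := by
        by_contra! h'
        exact hq h'
      obtain ⟨x, hx, hx'⟩ := hp'
      obtain ⟨y, hy, hy'⟩ := hq'
      obtain ⟨z, hz, hz1, hz2⟩ := Z.isIrreducible.isPreirreducible _ _
        (isOpen_setOf_ne_zero p.2) (isOpen_setOf_ne_zero q.2) ⟨x, hx, hx'⟩ ⟨y, hy, hy'⟩
      exact mul_ne_zero hz1 hz2 (hpq z hz)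
  refine Order.krullDim_le_of_strictMono
    (fun Z => (⟨I (OrderDual.ofDual Z), hI _⟩ : PrimeSpectrum (polyFun k E))) ?_
  refine Monotone.strictMono_of_injective ?_ ?_
  · intro Z Z' h p hp x hx
    exact hp x (h hx)
  · have key (Z : TopologicalSpace.IrreducibleCloseds E) :
        (Z : Set E) = {x | ∀ p ∈ I Z, (p : E → k) x = 0} := by
      obtain ⟨S, hS, hZ⟩ := (isClosed_iff_zeros (k := k)).1 Z.isClosed
      refine Set.Subset.antisymm (fun x hx p hp => hp x hx) fun x hx => ?_
      rw [hZ]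
      intro p hp
      refine hx ⟨p, hS hp⟩ fun y hy => ?_
      have : y ∈ (Z : Set E) := hy
      rw [hZ] at this
      exact this p hp
    intro Z Z' h
    have h' : I (OrderDual.ofDual Z) = I (OrderDual.ofDual Z') := congrArg PrimeSpectrum.asIdeal h
    refine OrderDual.ofDual.injective (SetLike.coe_injective ?_)
    rw [key, key (OrderDual.ofDual Z'), h']

variable (k) in
theorem isClosed_add_submodule [TopologicalSpace E] [ZariskiSpace k E] (x : E)
    (L : Submodule k E) : IsClosed {y | y - x ∈ L} := by
  rw [isClosed_iff_zeros (k := k)]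
  refine ⟨{p | p ∈ polyFun k E ∧ ∀ y, y - x ∈ L → p y = 0}, fun p hp => hp.1, ?_⟩
  refine Set.Subset.antisymm (fun y hy p hp => hp.2 y hy) fun y hy => ?_
  by_contra h
  obtain ⟨φ, hφ, hL⟩ := L.exists_dual_map_eq_bot_of_notMem h inferInstance
  refine hφ ?_
  have h1 : (fun z => φ z - φ x) ∈ polyFun k E :=
    sub_mem (dual_mem_polyFun φ) (Subalgebra.algebraMap_mem (polyFun k E) (φ x))
  have := hy _ ⟨h1, fun z hz => ?_⟩
  · simpa using this
  · have hm : φ (z - x) ∈ L.map φ := ⟨_, hz, rfl⟩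
    rw [hL] at hm
    simpa using hm

variable (k) in
/-- A nonempty open subset of a vector space has the dimension of that space. -/
theorem topologicalKrullDim_of_isOpen [Infinite k] [TopologicalSpace E] [ZariskiSpace k E]
    {U : Set E} (hU : IsOpen U) (hne : U.Nonempty) :
    topologicalKrullDim U = Module.finrank k E := by
  refine le_antisymm ((topologicalKrullDim_subspace_le E U).trans
    (topologicalKrullDim_le_finrank k E)) ?_
  obtain ⟨x, hx⟩ := hne
  let b := Module.finBasis k E
  -- The lower bound comes from the traces on `U` of a full flag of affine subspaces through `x`.
  let L (i : Fin (Module.finrank k E + 1)) : Submodule k E := b.flag i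
  have hirr (i) : IsIrreducible {y : U | (y : E) - x ∈ L i} := by
    refine ⟨⟨⟨x, hx⟩, by simp⟩, ?_⟩
    have : IsPreirreducible {y | y - x ∈ L i} := by
      refine isPreirreducible_of_line_mem k fun y hy z hz t => ?_
      have : y + t • (z - y) - x = (y - x) + t • ((z - x) - (y - x)) := by
        rw [sub_sub_sub_cancel_right]
        abel
      rw [Set.mem_ofPred_eq, this]
      exact add_mem hy (Submodule.smul_mem _ _ (sub_mem hz hy))
    exact this.preimage hU.isOpenEmbedding_subtypeVal
  let Z (i : Fin (Module.finrank k E + 1)) : TopologicalSpace.IrreducibleCloseds U :=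
    ⟨{y : U | (y : E) - x ∈ L i}, hirr i,
      (isClosed_add_submodule k x (L i)).preimage continuous_subtype_val⟩
  have hZ : StrictMono Z := by
    rw [Fin.strictMono_iff_lt_succ]
    intro i
    have hle : L i.castSucc ≤ L i.succ := b.flag_mono (Fin.castSucc_lt_succ).le
    refine lt_of_le_of_ne (fun y hy => hle hy) fun h => ?_
    have hmem : b i ∈ L i.succ := b.self_mem_flag (Fin.castSucc_lt_succ)
    have hnot : b i ∉ L i.castSucc := fun h' =>
      absurd (b.self_mem_flag_iff.1 h') (lt_irrefl _)
    -- The line through `x` in the direction `b i` has a point of `U` outside the smaller subspace,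
    -- so the inclusion of traces is strict.
    obtain ⟨t, ht, ht0⟩ := exists_line_mem (k := k) hU
      (isClosed_add_submodule k x (L i.castSucc)).isOpen_compl (x := x) (y := x + b i) hx
      (by simpa using hnot)
    rw [add_sub_cancel_left] at ht ht0
    refine ht0 ?_
    have : (⟨_, ht⟩ : U) ∈ Z i.succ := by
      change x + t • b i - x ∈ L i.succ
      rw [add_sub_cancel_left]
      exact Submodule.smul_mem _ _ hmem
    rw [← h] at this
    exact this
  exact Order.LTSeries.length_le_krullDim (LTSeries.mk (Module.finrank k E) Z hZ)

end Dimension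

/-! ### A basis of the symmetric square -/

section SymSq

variable {k : Type*} [Field k] {V : Type*} [AddCommGroup V] [Module k V]

/-- The product `V × V → S²V`. -/
def symMul : V →ₗ[k] V →ₗ[k] SymSq k V := TensorProduct.curry (Submodule.mkQ _)

theorem symMul_comm (v w : V) : symMul (k := k) v w = symMul w v := by
  refine (Submodule.Quotient.eq _).2 (Submodule.subset_span ⟨v, w, rfl⟩)

variable {ι : Type*} (e : Module.Basis ι k V)

/-- The coordinates of `S²V` in the basis of the products of two basis vectors. -/
def symSqEquiv : SymSq k V ≃ₗ[k] (Sym2 ι →₀ k) :=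
  LinearEquiv.ofLinearMap
    (Submodule.liftQ _ (TensorProduct.lift
        (e.constr k fun i => e.constr k fun j => Finsupp.single s(i, j) (1 : k))) (by
      rw [Submodule.span_le]
      rintro _ ⟨v, w, rfl⟩
      have : (e.constr k fun i => e.constr k fun j => Finsupp.single s(i, j) (1 : k)) =
          (e.constr k fun i => e.constr k fun j => Finsupp.single s(i, j) (1 : k)).flip := by
        refine e.ext fun i => e.ext fun j => ?_
        simp [Sym2.eq_swap]
      have h := LinearMap.congr_fun₂ this v w
      rw [LinearMap.flip_apply] at h
      simp [h]))
    (Finsupp.linearCombination k (Sym2.lift ⟨fun i j => symMul (e i) (e j),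
      fun i j => symMul_comm _ _⟩))
    (by
      refine Finsupp.lhom_ext' fun s => LinearMap.ext_ring ?_
      induction s using Sym2.ind with
      | _ i j => simp [symMul])
    (by
      refine Submodule.linearMap_qext _ (TensorProduct.ext' fun v w => ?_)
      have : (TensorProduct.mk k V V).compr₂ ((Finsupp.linearCombination k
          (Sym2.lift ⟨fun i j => symMul (e i) (e j), fun i j => symMul_comm _ _⟩)) ∘ₗ
          TensorProduct.lift (e.constr k fun i => e.constr k fun j =>
            Finsupp.single s(i, j) (1 : k))) = symMul := by
        refine e.ext fun i => e.ext fun j => ?_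
        simp
      exact LinearMap.congr_fun₂ this v w)

/-- The basis of `S²V` consisting of the products of two basis vectors. -/
def symSqBasis : Module.Basis (Sym2 ι) k (SymSq k V) := .ofRepr (symSqEquiv e)

theorem symSqBasis_mk (i j : ι) : symSqBasis e s(i, j) = symMul (e i) (e j) := by
  change (symSqEquiv e).symm (Finsupp.single s(i, j) 1) = _
  simp [symSqEquiv]

theorem finrank_symSq [FiniteDimensional k V] :
    Module.finrank k (SymSq k V) = (Module.finrank k V + 1).choose 2 := by
  rw [Module.finrank_eq_card_basis (symSqBasis (Module.finBasis k V)), Sym2.card, Fintype.card_fin]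

end SymSq

/-! ### The maps `m(1)` and `g*`, and the loci expressed through `g` -/

section Maps

variable {k : Type*} [Field k]
  {A B V : Type*} [AddCommGroup A] [Module k A] [AddCommGroup B] [Module k B]
  [AddCommGroup V] [Module k V]
  {F : Type*} [AddCommGroup F] [Module k F]

variable (k A B V) in
/-- The map `m ↦ m(1)`, as a linear map. -/
def oneHom : (B →ₗ[k] A ⊗[k] V) →ₗ[k] (B ⊗[k] V →ₗ[k] A ⊗[k] SymSq k V) :=
  LinearMap.compRight k (prodMap k A V) ∘ₗ LinearMap.rTensorHom V

variable (k A V F) in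
/-- The map `g ↦ g*`, as a linear map. -/
def formStarHom : (A ⊗[k] SymSq k V →ₗ[k] F) →ₗ[k] (A ⊗[k] V →ₗ[k] (V →ₗ[k] F)) :=
  TensorProduct.lcurry (.id k) _ _ _ ∘ₗ LinearMap.lcomp k F (prodMap k A V)

theorem formStar_apply (g : A ⊗[k] SymSq k V →ₗ[k] F) (x : A ⊗[k] V) (v : V) :
    formStar g x v = g (prodMap k A V (x ⊗ₜ v)) := rfl

theorem one_tmul (m : B →ₗ[k] A ⊗[k] V) (b : B) (v : V) :
    one m (b ⊗ₜ v) = prodMap k A V (m b ⊗ₜ v) := rfl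

theorem prodMap_tmul (x : A) (v w : V) :
    prodMap k A V ((x ⊗ₜ v) ⊗ₜ w) = x ⊗ₜ symMul v w := rfl

theorem mem_Zstar {Z : Submodule k (A ⊗[k] SymSq k V)} {x : A ⊗[k] V} :
    x ∈ Zstar Z ↔ ∀ v : V, prodMap k A V (x ⊗ₜ v) ∈ Z := by
  rw [Zstar, LinearMap.mem_ker, LinearMap.ext_iff]
  simp [formStar_apply]

theorem mem_homStar {Z : Submodule k (A ⊗[k] SymSq k V)} {m : B →ₗ[k] A ⊗[k] V} :
    m ∈ homStar B Z ↔ Zof m ≤ Z := by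
  constructor
  · rintro h _ ⟨x, rfl⟩
    induction x with
    | zero => simp
    | add x y hx hy => simpa using add_mem hx hy
    | tmul b v => exact mem_Zstar.1 (h ⟨b, rfl⟩) v
  · rintro h _ ⟨b, rfl⟩
    exact mem_Zstar.2 fun v => h ⟨b ⊗ₜ v, rfl⟩

theorem Zstar_ker (g : A ⊗[k] SymSq k V →ₗ[k] F) :
    Zstar (LinearMap.ker g) = LinearMap.ker (formStar g) := by
  ext x
  rw [mem_Zstar, LinearMap.mem_ker, LinearMap.ext_iff]
  rfl

theorem mem_homStar_ker {g : A ⊗[k] SymSq k V →ₗ[k] F} {m : B →ₗ[k] A ⊗[k] V} :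
    m ∈ homStar B (LinearMap.ker g) ↔ formStar g ∘ₗ m = 0 := by
  rw [homStar, Set.mem_ofPred_eq, Zstar_ker, LinearMap.range_le_ker_iff]

/-- The adjunction behind everything: both sides say that `g` vanishes on all products of `m b` with
`v`. For fixed `g` it turns an inclusion into a linear condition on `m`. -/
theorem Zof_le_ker {g : A ⊗[k] SymSq k V →ₗ[k] F} {m : B →ₗ[k] A ⊗[k] V} :
    Zof m ≤ LinearMap.ker g ↔ formStar g ∘ₗ m = 0 := by
  rw [← mem_homStar, mem_homStar_ker]

theorem codim_ker {E F : Type*} [AddCommGroup E] [Module k E] [AddCommGroup F] [Module k F]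
    (g : E →ₗ[k] F) : codim k (LinearMap.ker g) = Module.finrank k (LinearMap.range g) :=
  g.quotKerEquivRange.finrank_eq

variable {f : ℕ}

theorem codim_ker_of_surjective {E : Type*} [AddCommGroup E] [Module k E]
    {g : E →ₗ[k] (Fin f → k)} (hg : Function.Surjective g) : codim k (LinearMap.ker g) = f := by
  rw [codim_ker, LinearMap.range_eq_top.2 hg, finrank_top, Module.finrank_fin_fun]

theorem exists_ker_eq {E : Type*} [AddCommGroup E] [Module k E] [FiniteDimensional k E]
    {Z : Submodule k E} (hZ : codim k Z = f) :
    ∃ g : E →ₗ[k] (Fin f → k), Function.Surjective g ∧ LinearMap.ker g = Z := by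
  have e : (E ⧸ Z) ≃ₗ[k] (Fin f → k) :=
    LinearEquiv.ofFinrankEq _ _ (by rw [Module.finrank_fin_fun]; exact hZ)
  exact ⟨e.toLinearMap ∘ₗ Z.mkQ, e.surjective.comp Z.mkQ_surjective, by simp [LinearEquiv.ker_comp]⟩

theorem codim_Zstar_ker [FiniteDimensional k V] (hV : Module.finrank k V = 4)
    (g : A ⊗[k] SymSq k V →ₗ[k] (Fin f → k)) :
    codim k (Zstar (LinearMap.ker g)) = 4 * f ↔ Function.Surjective (formStar g) := by
  have h4 : Module.finrank k (V →ₗ[k] (Fin f → k)) = 4 * f := by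
    rw [Module.finrank_linearMap, hV, Module.finrank_fin_fun]
  rw [Zstar_ker, codim_ker, surjective_iff_le_finrank_range, h4]
  refine ⟨fun h => h.ge, fun h => le_antisymm ?_ h⟩
  rw [← h4]
  exact Submodule.finrank_le _

/-- For `v ≠ 0`, evaluation at `v` maps `Hom(V, F)` onto `F`, and the values of `g*` at `v` are
values of `g`. -/
theorem surjective_of_formStar_surjective [Nontrivial V]
    {g : A ⊗[k] SymSq k V →ₗ[k] F} (hg : Function.Surjective (formStar g)) :
    Function.Surjective g := by
  intro y
  obtain ⟨v, hv⟩ := exists_ne (0 : V)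
  obtain ⟨φ, hφ⟩ := Module.Projective.exists_dual_ne_zero k hv
  obtain ⟨x, hx⟩ := hg (((φ v)⁻¹ • φ).smulRight y)
  refine ⟨prodMap k A V (x ⊗ₜ v), ?_⟩
  rw [← formStar_apply, hx]
  simp [hφ]

variable [FiniteDimensional k A] [FiniteDimensional k V]

theorem finrank_add_codim {E : Type*} [AddCommGroup E] [Module k E] [FiniteDimensional k E]
    (Z : Submodule k E) : Module.finrank k Z + codim k Z = Module.finrank k E := by
  rw [add_comm]
  exact Z.finrank_quotient_add_finrank

theorem finrank_tensor_symSq (hV : Module.finrank k V = 4) :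
    Module.finrank k (A ⊗[k] SymSq k V) = 10 * Module.finrank k A := by
  rw [Module.finrank_tensorProduct, finrank_symSq, hV, mul_comm]
  rfl

/-- If `dim B ⊗ V ≥ dim A ⊗ S²V`, the corank of `m(1)` is the codimension of its image. -/
theorem corank_one [FiniteDimensional k B] (hV : Module.finrank k V = 4)
    (hab : 5 * Module.finrank k A ≤ 2 * Module.finrank k B) (m : B →ₗ[k] A ⊗[k] V) :
    corank k (one m) = codim k (Zof m) := by
  refine min_eq_right ?_
  have h1 := (one m).finrank_range_add_finrank_ker
  have h2 := finrank_add_codim (Zof m)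
  rw [finrank_tensor_symSq hV] at h2
  rw [Module.finrank_tensorProduct, hV] at h1
  change Module.finrank k (Zof m) + _ = _ at h1
  change codim k (Zof m) ≤ _
  lia

theorem mem_locusW [FiniteDimensional k B] (hV : Module.finrank k V = 4)
    (hab : 5 * Module.finrank k A ≤ 2 * Module.finrank k B) {m : B →ₗ[k] A ⊗[k] V} :
    m ∈ locusW k A B V f ↔ f ≤ codim k (Zof m) := by
  rw [locusW, Set.mem_ofPred_eq, corank_one hV hab]

theorem mem_locusPW [FiniteDimensional k B] (hV : Module.finrank k V = 4)
    (hab : 5 * Module.finrank k A ≤ 2 * Module.finrank k B) {m : B →ₗ[k] A ⊗[k] V} :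
    m ∈ locusPW k A B V f ↔ codim k (Zof m) = f ∧ codim k (Zstar (Zof m)) = 4 * f := by
  rw [locusPW, Set.mem_ofPred_eq, mem_locusW hV hab]
  exact ⟨fun h => h.2, fun h => ⟨h.1.ge, h⟩⟩

theorem mem_locusPW_iff_exists [FiniteDimensional k B] (hV : Module.finrank k V = 4)
    (hab : 5 * Module.finrank k A ≤ 2 * Module.finrank k B) {m : B →ₗ[k] A ⊗[k] V} :
    m ∈ locusPW k A B V f ↔ ∃ g : A ⊗[k] SymSq k V →ₗ[k] (Fin f → k),
      Function.Surjective g ∧ LinearMap.ker g = Zof m ∧ Function.Surjective (formStar g) := by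
  rw [mem_locusPW hV hab]
  constructor
  · rintro ⟨h1, h2⟩
    obtain ⟨g, hg, hgZ⟩ := exists_ker_eq h1
    rw [← hgZ, codim_Zstar_ker hV] at h2
    exact ⟨g, hg, hgZ, h2⟩
  · rintro ⟨g, hg, hgZ, h⟩
    rw [← hgZ, codim_Zstar_ker hV]
    exact ⟨codim_ker_of_surjective hg, h⟩

/-- A morphism `m : B → Z*` satisfies `Im m(1) = Z` as soon as `m(1)` has the rank
`dim Z`. -/
theorem Zof_eq_ker (hV : Module.finrank k V = 4) {g : A ⊗[k] SymSq k V →ₗ[k] (Fin f → k)}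
    (hg : Function.Surjective g) {m : B →ₗ[k] A ⊗[k] V} (hm : formStar g ∘ₗ m = 0)
    (hr : 10 * Module.finrank k A - f ≤ Module.finrank k (LinearMap.range (one m))) :
    Zof m = LinearMap.ker g := by
  refine Submodule.eq_of_le_of_finrank_le (Zof_le_ker.2 hm) ?_
  have := finrank_add_codim (LinearMap.ker g)
  rw [codim_ker_of_surjective hg, finrank_tensor_symSq hV] at this
  change _ ≤ Module.finrank k (LinearMap.range (one m))
  lia

theorem finrank_range_one_of_Zof_eq_ker (hV : Module.finrank k V = 4)
    {g : A ⊗[k] SymSq k V →ₗ[k] (Fin f → k)} (hg : Function.Surjective g)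
    {m : B →ₗ[k] A ⊗[k] V} (hm : Zof m = LinearMap.ker g) :
    10 * Module.finrank k A - f ≤ Module.finrank k (LinearMap.range (one m)) := by
  have := finrank_add_codim (LinearMap.ker g)
  rw [codim_ker_of_surjective hg, finrank_tensor_symSq hV] at this
  change _ ≤ Module.finrank k (Zof m)
  rw [hm]
  lia

end Maps

/-! ### Direct sums of coordinate data -/

section Datum

/-- The position in the upper triangle of a symmetric `4 × 4` matrix of its entry `(r, s)`. -/
def symIndex (r s : Fin 4) : Fin 10 :=
  ![![0, 1, 2, 3], ![1, 4, 5, 6], ![2, 5, 7, 8], ![3, 6, 8, 9]] r s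

variable {k : Type*} [Field k]

/-- The value at `x` of a family of quadratic forms, in coordinates: the linear form
`∑ i, ∂Qᵢ/∂xᵢ`. -/
def contract {ι : Type*} [Fintype ι] (Q : ι → Fin 10 → k) (x : ι → Fin 4 → k) (r : Fin 4) : k :=
  ∑ i, ∑ s, Q i (symIndex r s) * x i s

/-- In coordinates: the subspace of `A ⊗ V` generated by the `u l` generates in `A ⊗ S²V` the
subspace `Z` of zeros of the forms `q j`, and `Z*` has the expected codimension. -/
structure IsDatum {ι L J : Type*} [Fintype ι] [Fintype J]
    (u : L → ι → Fin 4 → k) (q : J → ι → Fin 10 → k) : Prop where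
  contract_eq_zero : ∀ j l r, contract (q j) (u l) r = 0
  exists_eq_sum : ∀ Q : ι → Fin 10 → k, (∀ l r, contract Q (u l) r = 0) →
    ∃ c : J → k, ∀ i n, Q i n = ∑ j, c j * q j i n
  exists_contract_eq : ∀ y : J → Fin 4 → k, ∃ x : ι → Fin 4 → k, ∀ j r, contract (q j) x r = y j r

variable (k) in
/-- There is a coordinate datum with parameters `a`, `b`, `f`. -/
def HasDatum (a b f : ℕ) : Prop :=
  ∃ (ι L J : Type) (_ : Fintype ι) (_ : Fintype L) (_ : Fintype J),
    Fintype.card ι = a ∧ Fintype.card L = b ∧ Fintype.card J = f ∧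
      ∃ (u : L → ι → Fin 4 → k) (q : J → ι → Fin 10 → k), IsDatum u q

theorem HasDatum.zero : HasDatum k 0 0 0 :=
  ⟨Empty, Empty, Empty, inferInstance, inferInstance, inferInstance, rfl, rfl, rfl,
    fun l => l.elim, fun j => j.elim, fun j => j.elim,
    fun _ _ => ⟨fun j => j.elim, fun i => i.elim⟩,
    fun _ => ⟨fun i => i.elim, fun j => j.elim⟩⟩

theorem contract_sumElim {ι ι' : Type*} [Fintype ι] [Fintype ι'] (Q : ι ⊕ ι' → Fin 10 → k)
    (x : ι ⊕ ι' → Fin 4 → k) (r : Fin 4) :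
    contract Q x r = contract (fun i => Q (.inl i)) (fun i => x (.inl i)) r +
      contract (fun i => Q (.inr i)) (fun i => x (.inr i)) r := by
  simp [contract]

theorem contract_zero_left {ι : Type*} [Fintype ι] (x : ι → Fin 4 → k) (r : Fin 4) :
    contract (fun _ => 0) x r = 0 := by
  simp [contract]

theorem contract_zero_right {ι : Type*} [Fintype ι] (Q : ι → Fin 10 → k) (r : Fin 4) :
    contract Q (fun _ => 0) r = 0 := by
  simp [contract]

theorem HasDatum.add {a b f a' b' f' : ℕ} (h : HasDatum k a b f) (h' : HasDatum k a' b' f') :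
    HasDatum k (a + a') (b + b') (f + f') := by
  obtain ⟨ι, L, J, _, _, _, rfl, rfl, rfl, u, q, h1, h2, h3⟩ := h
  obtain ⟨ι', L', J', _, _, _, rfl, rfl, rfl, u', q', h1', h2', h3'⟩ := h'
  refine ⟨ι ⊕ ι', L ⊕ L', J ⊕ J', inferInstance, inferInstance, inferInstance,
    Fintype.card_sum, Fintype.card_sum, Fintype.card_sum,
    Sum.elim (fun l => Sum.elim (u l) fun _ => 0) (fun l => Sum.elim (fun _ => 0) (u' l)),
    Sum.elim (fun j => Sum.elim (q j) fun _ => 0) (fun j => Sum.elim (fun _ => 0) (q' j)),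
    ?_, ?_, ?_⟩
  · rintro (j | j) (l | l) r <;>
      simp [contract_sumElim, contract_zero_left, contract_zero_right, h1, h1']
  · intro Q hQ
    obtain ⟨c, hc⟩ := h2 (fun i => Q (.inl i)) fun l r => by
      simpa [contract_sumElim, contract_zero_right] using hQ (.inl l) r
    obtain ⟨c', hc'⟩ := h2' (fun i => Q (.inr i)) fun l r => by
      simpa [contract_sumElim, contract_zero_right] using hQ (.inr l) r
    refine ⟨Sum.elim c c', ?_⟩
    rintro (i | i) n <;> simp [hc, hc']
  · intro y
    obtain ⟨x, hx⟩ := h3 fun j => y (.inl j)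
    obtain ⟨x', hx'⟩ := h3' fun j => y (.inr j)
    refine ⟨Sum.elim x x', ?_⟩
    rintro (j | j) r <;> simp [contract_sumElim, contract_zero_left, hx, hx']

theorem HasDatum.mono {a b b' f : ℕ} (h : HasDatum k a b f) (hb : b ≤ b') :
    HasDatum k a b' f := by
  obtain ⟨ι, L, J, _, _, _, rfl, rfl, rfl, u, q, h1, h2, h3⟩ := h
  refine ⟨ι, L ⊕ Fin (b' - Fintype.card L), J, inferInstance, inferInstance, inferInstance, rfl,
    ?_, rfl, Sum.elim u fun _ _ => 0, q, ?_, ?_, h3⟩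
  · simp only [Fintype.card_sum, Fintype.card_fin]
    lia
  · rintro j (l | l) r
    · exact h1 j l r
    · exact contract_zero_right _ _
  · exact fun Q hQ => h2 Q fun l r => hQ (.inl l) r

theorem HasDatum.nsmul {a b f : ℕ} (h : HasDatum k a b f) (n : ℕ) :
    HasDatum k (n * a) (n * b) (n * f) := by
  induction n with
  | zero => simpa using HasDatum.zero
  | succ n ih => simpa only [add_mul, one_mul] using ih.add h

/-- The family of quadratic forms with the listed nonzero coefficients. -/
def sparseForm {a : ℕ} (t : List (Fin a × Fin 10 × ℤ)) (i : Fin a) (n : Fin 10) : ℤ :=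
  (t.map fun t => if t.1 = i ∧ t.2.1 = n then t.2.2 else 0).sum

theorem contract_single {ι : Type*} [Fintype ι] [DecidableEq ι] (Q : ι → Fin 10 → k)
    (p : ι × Fin 4) (c : k) (r : Fin 4) :
    contract Q (fun i s => if (i, s) = p then c else 0) r = Q p.1 (symIndex r p.2) * c := by
  rw [contract, ← Fintype.sum_prod_type' (f := fun i s => Q i (symIndex r s) *
    if (i, s) = p then c else 0)]
  simp

theorem contract_add_right {ι : Type*} [Fintype ι] (Q : ι → Fin 10 → k) (x y : ι → Fin 4 → k)
    (r : Fin 4) : contract Q (fun i s => x i s + y i s) r = contract Q x r + contract Q y r := by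
  simp [contract, mul_add, Finset.sum_add_distrib]

theorem contract_sum_right {ι : Type*} [Fintype ι] {σ : Type*} (S : Finset σ)
    (Q : ι → Fin 10 → k) (x : σ → ι → Fin 4 → k) (r : Fin 4) :
    contract Q (fun i s => ∑ t ∈ S, x t i s) r = ∑ t ∈ S, contract Q (x t) r := by
  classical
  induction S using Finset.induction_on with
  | empty => simp [contract]
  | insert t S ht ih => simp [Finset.sum_insert ht, contract_add_right, ih]

/-- A datum all of whose vectors have at most two nonzero coordinates. The vectors `x j r` prove
that `Z*` has the expected codimension. -/
theorem hasDatum_of_sparse {a b f : ℕ} (d : Fin b → (Fin a × Fin 4) × ℤ × (Fin a × Fin 4))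
    (q : Fin f → Fin a → Fin 10 → ℤ) (x : Fin f → Fin 4 → List (Fin a × Fin 4 × ℤ))
    (h1 : ∀ j l r, q j (d l).1.1 (symIndex r (d l).1.2) +
      (d l).2.1 * q j (d l).2.2.1 (symIndex r (d l).2.2.2) = 0)
    (h2 : ∀ Q : Fin a → Fin 10 → k, (∀ l r, Q (d l).1.1 (symIndex r (d l).1.2) +
      (d l).2.1 * Q (d l).2.2.1 (symIndex r (d l).2.2.2) = 0) →
      ∃ c : Fin f → k, ∀ i n, Q i n = ∑ j, c j * q j i n)
    (h3 : ∀ j r j' r', ((x j r).map fun t => q j' t.1 (symIndex r' t.2.1) * t.2.2).sum =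
      if j = j' ∧ r = r' then 1 else 0) :
    HasDatum k a b f := by
  have hu (Q : Fin a → Fin 10 → k) (l r) : contract Q (fun i s =>
      (if (i, s) = (d l).1 then 1 else 0) + if (i, s) = (d l).2.2 then ((d l).2.1 : k) else 0) r =
      Q (d l).1.1 (symIndex r (d l).1.2) +
        (d l).2.1 * Q (d l).2.2.1 (symIndex r (d l).2.2.2) := by
    rw [contract_add_right, contract_single, contract_single, mul_one, mul_comm]
  refine ⟨Fin a, Fin b, Fin f, inferInstance, inferInstance, inferInstance, Fintype.card_fin a,
    Fintype.card_fin b, Fintype.card_fin f, fun l i s => (if (i, s) = (d l).1 then 1 else 0) +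
      if (i, s) = (d l).2.2 then ((d l).2.1 : k) else 0, fun j i n => (q j i n : k), ?_, ?_, ?_⟩
  · intro j l r
    rw [hu]
    exact_mod_cast congrArg (Int.cast (R := k)) (h1 j l r)
  · intro Q hQ
    refine h2 Q fun l r => ?_
    rw [← hu]
    exact hQ l r
  · intro y
    let w (t : List (Fin a × Fin 4 × ℤ)) (i : Fin a) (s : Fin 4) : k :=
      (t.map fun t => if (i, s) = (t.1, t.2.1) then (t.2.2 : k) else 0).sum
    have hw (Q : Fin a → Fin 10 → ℤ) (t) (r : Fin 4) :
        contract (fun i n => (Q i n : k)) (w t) r =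
          (((t.map fun t => Q t.1 (symIndex r t.2.1) * t.2.2).sum : ℤ) : k) := by
      induction t with
      | nil => simp [w, contract]
      | cons t l ih =>
        have : w (t :: l) = fun i s =>
            (if (i, s) = (t.1, t.2.1) then (t.2.2 : k) else 0) + w l i s := by
          ext i s
          simp [w]
        rw [this, contract_add_right, ih, contract_single]
        simp
    -- By `h3` the vectors `x j r` are mapped to the standard basis of the target, so the preimage
    -- of `y` is the combination with coefficients `y`.
    refine ⟨fun i s => ∑ p : Fin f × Fin 4, y p.1 p.2 * w (x p.1 p.2) i s, fun j r => ?_⟩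
    rw [contract_sum_right]
    have (p : Fin f × Fin 4) : contract (fun i n => (q j i n : k))
        (fun i s => y p.1 p.2 * w (x p.1 p.2) i s) r = if p = (j, r) then y j r else 0 := by
      have e : contract (fun i n => (q j i n : k)) (fun i s => y p.1 p.2 * w (x p.1 p.2) i s) r =
          y p.1 p.2 * contract (fun i n => (q j i n : k)) (w (x p.1 p.2)) r := by
        simp only [contract, Finset.mul_sum]
        exact Finset.sum_congr rfl fun i _ => Finset.sum_congr rfl fun s _ => by ring
      rw [e, hw, h3]
      by_cases hp : p = (j, r)
      · simp [hp]
      · have : ¬ (p.1 = j ∧ p.2 = r) := fun h => hp (Prod.ext h.1 h.2)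
        simp [hp, this]
    simp [this]

end Datum

/-! ### A point of the locus, built from explicit blocks -/

section Existence

variable {k : Type*} [Field k]

section Generators

variable [CharZero k]

/-- The filler block: here `B ⊗ V` and `A ⊗ S²V` both have dimension 20 and `m(1)` is an
isomorphism, so `a` and `b` grow without changing `f`. -/
theorem hasDatum_two_five_zero : HasDatum k 2 5 0 := by
  refine hasDatum_of_sparse
    ![((1, 3), -1, (0, 2)), ((0, 0), -1, (1, 3)), ((1, 0), -1, (1, 3)), ((1, 2), -1, (0, 1)),
      ((0, 3), 1, (1, 1))] ![] ![] (by decide) (fun Q hQ => ⟨![], ?_⟩) (by decide)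
  simp [Fin.forall_fin_succ, symIndex] at hQ ⊢
  grind

theorem hasDatum_three_eight_one : HasDatum k 3 8 1 := by
  refine hasDatum_of_sparse
    ![((2, 1), 1, (2, 3)), ((1, 1), -1, (0, 3)), ((0, 2), 1, (1, 3)), ((2, 3), 1, (2, 0)), ((2,
      3), -1, (2, 1)), ((2, 2), -1, (0, 0)), ((2, 0), 1, (1, 2)), ((1, 0), 1, (0, 1))]
    ![sparseForm [(0, 2, 1), (0, 6, 1), (1, 3, -1), (1, 4, 1), (2, 7, 1)]]
    ![![[(0, 2, 1)], [(0, 3, 1)], [(0, 0, 1)], [(0, 1, 1)]]]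
    -- The form has coefficient 1 at the position `(2, 7)`, so the multiplier is read off there; the
    -- next blocks use the same device.
    (by decide +kernel) (fun Q hQ => ⟨![Q 2 7], ?_⟩) (by decide +kernel)
  simp [Fin.forall_fin_succ, symIndex, sparseForm] at hQ ⊢
  grind

theorem hasDatum_four_ten_one : HasDatum k 4 10 1 := by
  refine hasDatum_of_sparse
    ![((1, 0), 1, (2, 3)), ((1, 3), 1, (1, 3)), ((2, 1), 1, (3, 0)), ((0, 2), -1, (3, 2)), ((3,
      3), -1, (0, 0)), ((2, 0), -1, (0, 3)), ((0, 1), -1, (1, 2)), ((0, 3), -1, (3, 2)), ((2, 2),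
      1, (3, 1)), ((0, 3), -1, (1, 1))]
    ![sparseForm [(0, 1, 1), (1, 2, 1), (2, 8, -1), (3, 6, 1)]]
    ![![[(0, 1, 1)], [(0, 0, 1)], [(1, 0, 1)], [(2, 2, -1)]]]
    (by decide +kernel) (fun Q hQ => ⟨![Q 3 6], ?_⟩) (by decide +kernel)
  simp [Fin.forall_fin_succ, symIndex, sparseForm] at hQ ⊢
  grind

theorem hasDatum_five_twelve_two : HasDatum k 5 12 2 := by
  refine hasDatum_of_sparse
    ![((0, 3), 1, (2, 1)), ((2, 0), 1, (1, 3)), ((1, 2), 1, (3, 1)), ((4, 3), 1, (1, 1)), ((0,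
      0), 1, (3, 3)), ((2, 1), 1, (2, 1)), ((3, 2), 1, (2, 0)), ((4, 2), 1, (1, 1)), ((0, 2), 1,
      (2, 3)), ((1, 0), 1, (4, 1)), ((3, 0), 1, (0, 1)), ((4, 0), -1, (2, 2))]
    ![sparseForm [(0, 1, -1), (1, 8, -1), (2, 2, 1), (3, 0, 1), (3, 6, 1), (3, 7, -1), (4, 0,
      1)], sparseForm [(0, 7, -1), (1, 1, -1), (2, 7, 1), (2, 8, 1), (4, 2, 1), (4, 3, 1), (4, 4,
      1)]]
    ![![[(0, 1, -1)], [(0, 0, -1)], [(1, 3, -1)], [(1, 2, -1)]], ![[(1, 1, -1)], [(1, 0, -1)],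
      [(0, 2, -1)], [(0, 1, 1), (0, 2, 1), (2, 2, 1)]]]
    -- At the positions `(4, 0)` and `(4, 4)` the two forms have coefficients 1, 0 and 0, 1
    -- respectively.
    (by decide +kernel) (fun Q hQ => ⟨![Q 4 0, Q 4 4], ?_⟩) (by decide +kernel)
  simp [Fin.forall_fin_succ, symIndex, sparseForm] at hQ ⊢
  grind

theorem hasDatum_six_fifteen_two : HasDatum k 6 15 2 := by
  refine hasDatum_of_sparse
    ![((4, 1), -1, (5, 3)), ((4, 0), -1, (4, 1)), ((4, 2), -1, (4, 1)), ((2, 2), -1, (4, 3)),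
      ((2, 3), 1, (5, 1)), ((0, 3), -1, (1, 0)), ((0, 1), -1, (3, 2)), ((5, 0), -1, (0, 0)), ((4,
      1), -1, (1, 2)), ((3, 1), 1, (1, 3)), ((1, 2), 1, (3, 1)), ((3, 3), -1, (0, 2)), ((5, 2),
      1, (2, 0)), ((0, 0), 1, (1, 1)), ((3, 0), 1, (2, 1))]
    ![sparseForm [(0, 0, 1), (0, 6, -1), (0, 7, -1), (1, 1, -1), (3, 8, -1), (5, 0, 1)],
      sparseForm [(2, 1, -1), (2, 8, -1), (3, 0, 1), (4, 9, -1), (5, 5, 1)]]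
    ![![[(0, 0, 1)], [(0, 3, -1)], [(0, 2, -1)], [(0, 1, -1)]], ![[(2, 1, -1)], [(2, 0, -1)],
      [(2, 3, -1)], [(2, 2, -1)]]]
    (by decide +kernel) (fun Q hQ => ⟨![Q 5 0, Q 5 5], ?_⟩) (by decide +kernel)
  simp [Fin.forall_fin_succ, symIndex, sparseForm] at hQ ⊢
  grind

/-- Write `f = 4j + f₀` with `f₀ < 4`. Take `j` blocks `(10, 25, 4)`, one block `(2c₀, 5c₀, f₀)`
where `c₀` is the least integer with `5f₀ ≤ 4c₀`, namely 0, 2, 3 or 4, and fill up with blocks `(2,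
5, 0)`. The hypothesis is exactly `5j + c₀ ≤ c`. -/
theorem hasDatum_even {c f : ℕ} (h : 5 * f ≤ 4 * c) : HasDatum k (2 * c) (5 * c) f := by
  have h10 : HasDatum k 10 25 4 :=
    (hasDatum_five_twelve_two.add hasDatum_five_twelve_two).mono (by norm_num)
  have key (c₀ f₀ j : ℕ) (h0 : HasDatum k (2 * c₀) (5 * c₀) f₀) (hf : f = 4 * j + f₀)
      (hc : 5 * j + c₀ ≤ c) : HasDatum k (2 * c) (5 * c) f := by
    convert ((h10.nsmul j).add (hasDatum_two_five_zero.nsmul (c - 5 * j - c₀))).add h0 using 1 <;>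
      lia
  have hf := Nat.div_add_mod f 4
  have hr : f % 4 < 4 := Nat.mod_lt _ (by norm_num)
  obtain hr | hr | hr | hr : f % 4 = 0 ∨ f % 4 = 1 ∨ f % 4 = 2 ∨ f % 4 = 3 := by lia
  · exact key 0 0 (f / 4) HasDatum.zero (by lia) (by lia)
  · exact key 2 1 (f / 4) hasDatum_four_ten_one (by lia) (by lia)
  · exact key 3 2 (f / 4) hasDatum_six_fifteen_two (by lia) (by lia)
  · exact key 4 3 (f / 4) (hasDatum_five_twelve_two.add hasDatum_three_eight_one)
      (by lia) (by lia)

theorem hasDatum {a b f : ℕ} (hf : 1 ≤ f) (hab : 5 * a ≤ 2 * b) (haf : 5 * f < 2 * a) :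
    HasDatum k a b f := by
  obtain ⟨c, rfl | rfl⟩ := Nat.even_or_odd' a
  · exact (hasDatum_even (by lia)).mono (by lia)
  -- For `a = 2c + 1` one block `(3, 8, 1)` is split off. The strict inequality `5f < 4c + 2` is
  -- what gives `5(f - 1) ≤ 4(c - 1)`, and integrality of `b` gives `b ≥ 5c + 3`.
  · have h := (hasDatum_even (k := k) (c := c - 1) (f := f - 1) (by lia)).add
      hasDatum_three_eight_one
    have h' := h.mono (b' := b) (by lia)
    convert h' using 1 <;> lia

end Generators

variable {A B V : Type*} [AddCommGroup A] [Module k A] [AddCommGroup B] [Module k B]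
  [AddCommGroup V] [Module k V]

/-- The bijection of the unordered pairs with the positions in the upper triangle. -/
def symIndexEquiv : Sym2 (Fin 4) ≃ Fin 10 :=
  Equiv.ofBijective (Sym2.lift ⟨symIndex, by decide⟩) (by decide +kernel)

theorem exists_of_hasDatum [FiniteDimensional k A] [FiniteDimensional k B] [FiniteDimensional k V]
    (hV : Module.finrank k V = 4) {f : ℕ}
    (h : HasDatum k (Module.finrank k A) (Module.finrank k B) f) :
    ∃ (m : B →ₗ[k] A ⊗[k] V) (g : A ⊗[k] SymSq k V →ₗ[k] (Fin f → k)),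
      Function.Surjective (formStar g) ∧ Zof m = LinearMap.ker g := by
  obtain ⟨ι, L, J, _, _, _, hι, hL, hJ, u, q, h1, h2, h3⟩ := h
  let eA : Module.Basis ι k A := (Module.finBasis k A).reindex (Fintype.equivFinOfCardEq hι).symm
  let eB : Module.Basis L k B := (Module.finBasis k B).reindex (Fintype.equivFinOfCardEq hL).symm
  let eV : Module.Basis (Fin 4) k V := (Module.finBasis k V).reindex (finCongr hV)
  let eS : Module.Basis (Fin 10) k (SymSq k V) := (symSqBasis eV).reindex symIndexEquiv
  have heS (r s : Fin 4) : eS (symIndex r s) = symMul (eV s) (eV r) := by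
    have : symIndexEquiv.symm (symIndex r s) = s(r, s) := by
      rw [Equiv.symm_apply_eq]
      rfl
    rw [Module.Basis.reindex_apply, this, symSqBasis_mk, symMul_comm]
  let eE := eA.tensorProduct eS
  have heE (p) : eE p = eA p.1 ⊗ₜ eS p.2 := eA.tensorProduct_apply' eS p
  let ε := Fintype.equivFinOfCardEq hJ
  let ψ (Q : ι → Fin 10 → k) : Module.Dual k (A ⊗[k] SymSq k V) :=
    eE.constr k fun p => Q p.1 p.2
  let vec (x : ι → Fin 4 → k) : A ⊗[k] V := ∑ i, ∑ s, x i s • (eA i ⊗ₜ[k] eV s)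
  have hψ (Q) (i) (n) : ψ Q (eA i ⊗ₜ eS n) = Q i n := by
    rw [← heE (i, n), Module.Basis.constr_basis]
  have key (Q x r) : ψ Q (prodMap k A V (vec x ⊗ₜ eV r)) = contract Q x r := by
    simp only [vec, TensorProduct.sum_tmul, map_sum, map_smul,
      prodMap_tmul, ← heS, contract, hψ, smul_eq_mul, ← TensorProduct.smul_tmul']
    simp only [mul_comm]
  let m : B →ₗ[k] A ⊗[k] V := eB.constr k fun l => vec (u l)
  have hm (l) : m (eB l) = vec (u l) := eB.constr_basis k _ l
  let g : A ⊗[k] SymSq k V →ₗ[k] (Fin f → k) := LinearMap.pi fun j => ψ (q (ε.symm j))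
  have hle : Zof m ≤ LinearMap.ker g := by
    rw [Zof_le_ker]
    refine eB.ext fun l => eV.ext fun r => funext fun j => ?_
    rw [LinearMap.comp_apply, hm, formStar_apply]
    exact (key _ _ _).trans (h1 _ _ _)
  refine ⟨m, g, fun h => ?_, le_antisymm hle fun x hx => ?_⟩
  · obtain ⟨x, hx⟩ := h3 fun j r => h (eV r) (ε j)
    refine ⟨vec x, eV.ext fun r => funext fun j => ?_⟩
    rw [formStar_apply]
    refine (key _ _ _).trans ?_
    rw [hx, Equiv.apply_symm_apply]
  -- Duality: a linear form that vanishes on `Z_m` but not at `x` has coefficients contracting to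
  -- zero with every `u l`, so it is a combination of the `q j` and vanishes on `ker g`, which
  -- contains `x`.
  · by_contra hxm
    obtain ⟨φ, hφ, hφm⟩ := (Zof m).exists_dual_map_eq_bot_of_notMem hxm inferInstance
    have hφψ : φ = ψ fun i n => φ (eA i ⊗ₜ eS n) := by
      refine eE.ext fun p => ?_
      rw [Module.Basis.constr_basis, heE]
    obtain ⟨c, hc⟩ := h2 (fun i n => φ (eA i ⊗ₜ eS n)) fun l r => by
      rw [← key, ← hφψ, ← hm, ← one_tmul]
      have : φ (one m (eB l ⊗ₜ eV r)) ∈ (Zof m).map φ := ⟨_, ⟨_, rfl⟩, rfl⟩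
      rw [hφm] at this
      simpa using this
    have hsum : φ = ∑ j, c j • ψ (q j) := by
      refine eE.ext fun p => ?_
      simp [heE, hc, hψ]
    refine hφ ?_
    rw [hsum, LinearMap.sum_apply]
    refine Finset.sum_eq_zero fun j _ => ?_
    have := congrFun (LinearMap.mem_ker.1 hx) (ε j)
    simp only [g, LinearMap.pi_apply, Equiv.symm_apply_apply, Pi.zero_apply] at this
    simp [this]

end Existence

/-! ### Regular families of projections onto kernels -/

section ProjKer

variable {k : Type*} [Field k]
variable {E : Type*} [AddCommGroup E] [Module k E]
variable {F : Type*} [AddCommGroup F] [Module k F]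
variable {G : Type*} [AddCommGroup G] [Module k G]
variable {H : Type*} [AddCommGroup H] [Module k H]

theorem RegularOn.linearMap_comp [FiniteDimensional k G] [FiniteDimensional k H] {X : Set E}
    {S : E → G →ₗ[k] H} {T : E → F →ₗ[k] G} (hS : RegularOn k S X) (hT : RegularOn k T X) :
    RegularOn k (fun x => S x ∘ₗ T x) X :=
  RegularOn.bilin (LinearMap.llcomp k F G H) hS hT

theorem regularOn_id (X : Set E) : RegularOn k (fun x : E => x) X :=
  (RegularOn.linear (LinearMap.id : E →ₗ[k] E) X :)

theorem regularOn_fst (X : Set (E × F)) : RegularOn k (fun p : E × F => p.1) X :=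
  (RegularOn.linear (LinearMap.fst k E F) X :)

theorem regularOn_snd (X : Set (E × F)) : RegularOn k (fun p : E × F => p.2) X :=
  (RegularOn.linear (LinearMap.snd k E F) X :)

/-- The projection to the kernel of `Φ` along the image of `s`, when `Φ ∘ s` is invertible. -/
def projKer (s : H →ₗ[k] F) (Φ : F →ₗ[k] H) : F →ₗ[k] F :=
  LinearMap.id - s ∘ₗ (Ring.inverse (Φ ∘ₗ s : Module.End k H)) ∘ₗ Φ

variable {s : H →ₗ[k] F} {Φ : F →ₗ[k] H}

theorem comp_projKer (h : IsUnit (Φ ∘ₗ s : Module.End k H)) : Φ ∘ₗ projKer s Φ = 0 := by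
  have := Ring.mul_inverse_cancel _ h
  ext x
  have hx := LinearMap.congr_fun this (Φ x)
  simp only [Module.End.mul_apply, LinearMap.comp_apply, Module.End.one_apply] at hx
  simp [projKer, hx]

theorem projKer_comp (h : IsUnit (Φ ∘ₗ s : Module.End k H)) : projKer s Φ ∘ₗ s = 0 := by
  have := Ring.inverse_mul_cancel _ h
  ext x
  have hx := LinearMap.congr_fun this x
  simp only [Module.End.mul_apply, LinearMap.comp_apply, Module.End.one_apply] at hx
  simp [projKer, hx]

theorem projKer_comp_of_comp_eq_zero {m : G →ₗ[k] F} (hm : Φ ∘ₗ m = 0) :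
    projKer s Φ ∘ₗ m = m := by
  ext x
  have hx := LinearMap.congr_fun hm x
  simp only [LinearMap.comp_apply, LinearMap.zero_apply] at hx
  simp [projKer, hx]

theorem surjective_of_isUnit_comp (h : IsUnit (Φ ∘ₗ s : Module.End k H)) :
    Function.Surjective Φ :=
  Function.Surjective.of_comp (g := s) ((Module.End.isUnit_iff _).1 h).2

theorem exists_section (h : Function.Surjective Φ) : ∃ s : H →ₗ[k] F, Φ ∘ₗ s = LinearMap.id :=
  Φ.exists_rightInverse_of_surjective (LinearMap.range_eq_top.2 h)

theorem RegularOn.projKer [FiniteDimensional k F] [FiniteDimensional k H] {X : Set E}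
    {Ψ : E → F →ₗ[k] H} (hΨ : RegularOn k Ψ X)
    (hX : ∀ x ∈ X, IsUnit (Ψ x ∘ₗ s : Module.End k H)) :
    RegularOn k (fun x => projKer s (Ψ x)) X :=
  (RegularOn.const _ X).sub ((RegularOn.const s X).linearMap_comp
    ((RegularOn.inverse (hΨ.linearMap_comp (RegularOn.const s X)) hX).linearMap_comp hΨ))

/-- Two surjective linear maps have a common partial section. -/
theorem exists_isUnit_comp_and [Infinite k] [FiniteDimensional k F] [FiniteDimensional k H]
    {Φ Φ' : F →ₗ[k] H} (h : Function.Surjective Φ) (h' : Function.Surjective Φ') :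
    ∃ s : H →ₗ[k] F, IsUnit (Φ ∘ₗ s : Module.End k H) ∧ IsUnit (Φ' ∘ₗ s : Module.End k H) := by
  obtain ⟨s, hs⟩ := exists_section h
  obtain ⟨s', hs'⟩ := exists_section h'
  have hopen (Ψ : F →ₗ[k] H) :
      IsOpen {t : H →ₗ[k] F | t ∈ Set.univ ∧ IsUnit (Ψ ∘ₗ t : Module.End k H)} :=
    isOpen_setOf_isUnit isOpen_univ (RegularOn.linear (LinearMap.compRight k Ψ) _)
  -- A section of `Φ` and a section of `Φ'` show that both open conditions on `t` can be met; the
  -- line joining them meets both at once.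
  obtain ⟨t, ht, ht'⟩ := exists_line_mem (k := k) (hopen Φ) (hopen Φ') (x := s) (y := s')
    ⟨trivial, by rw [hs]; exact isUnit_one⟩ ⟨trivial, by rw [hs']; exact isUnit_one⟩
  exact ⟨_, ht.2, ht'.2⟩

end ProjKer

/-! ### Open sets and irreducibility of the Grassmannian -/

section Grassmannian

variable {k : Type*} [Field k] {E : Type*} [AddCommGroup E] [Module k E] [FiniteDimensional k E]
  {f : ℕ} {N : Type*} [AddCommGroup N] [Module k N]

theorem exists_eq_kerGr (Z : Module.Grassmannian k E f) :
    ∃ (g : E →ₗ[k] (Fin f → k)) (hg : Function.Surjective g), Z = kerGr g hg := by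
  have h : codim k Z.toSubmodule = f := by
    have := Z.rankAtStalk_eq default
    rwa [Module.rankAtStalk_eq_finrank_of_free, Pi.natCast_apply] at this
  obtain ⟨g, hg, hgZ⟩ := exists_ker_eq h
  exact ⟨g, hg, Module.Grassmannian.ext hgZ.symm⟩

/-- Surjectivity is an open condition, so openness in the subspace of surjective maps is openness in
the whole vector space, where lines are available. -/
theorem isOpen_gr_iff {U : Set (Module.Grassmannian k E f)} :
    IsOpen U ↔ IsOpen {g : E →ₗ[k] (Fin f → k) | ∃ hg : Function.Surjective g, kerGr g hg ∈ U} := by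
  have hs : IsOpen {g : E →ₗ[k] (Fin f → k) | g ∈ Set.univ ∧ Function.Surjective g} :=
    isOpen_setOf_surjective isOpen_univ (regularOn_id _)
  rw [isOpen_coinduced, isOpen_induced_iff]
  constructor
  · rintro ⟨O, hO, h⟩
    convert hs.inter hO using 1
    ext g
    constructor
    · rintro ⟨hg, hgU⟩
      have : (⟨g, hg⟩ : {g : E →ₗ[k] (Fin f → k) // Function.Surjective g}) ∈
        Subtype.val ⁻¹' O := h ▸ hgU
      exact ⟨⟨trivial, hg⟩, this⟩
    · rintro ⟨⟨-, hg⟩, hgO⟩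
      have : (⟨g, hg⟩ : {g : E →ₗ[k] (Fin f → k) // Function.Surjective g}) ∈
        Subtype.val ⁻¹' O := hgO
      rw [h] at this
      exact ⟨hg, this⟩
  · intro h
    refine ⟨_, h, ?_⟩
    ext g
    exact ⟨fun h => h.2, fun h => ⟨g.2, h⟩⟩

theorem isOpen_grProd_iff {U : Set (GrProd k E f N)} :
    IsOpen U ↔ @IsOpen _ (zariski k ((E →ₗ[k] (Fin f → k)) × N))
      {p | ∃ hp : Function.Surjective p.1, (⟨kerGr p.1 hp, p.2⟩ : GrProd k E f N) ∈ U} := by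
  let : TopologicalSpace ((E →ₗ[k] (Fin f → k)) × N) := zariski k _
  have : ZariskiSpace k ((E →ₗ[k] (Fin f → k)) × N) := ⟨rfl⟩
  have hs : IsOpen {p : (E →ₗ[k] (Fin f → k)) × N | p ∈ Set.univ ∧ Function.Surjective p.1} :=
    isOpen_setOf_surjective isOpen_univ (regularOn_fst _)
  rw [isOpen_coinduced, isOpen_induced_iff]
  constructor
  · rintro ⟨O, hO, h⟩
    convert hs.inter hO using 1
    ext p
    constructor
    · rintro ⟨hp, hpU⟩
      have : (⟨p, hp⟩ : {p : (E →ₗ[k] (Fin f → k)) × N // Function.Surjective p.1}) ∈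
        Subtype.val ⁻¹' O := h ▸ hpU
      exact ⟨⟨trivial, hp⟩, this⟩
    · rintro ⟨⟨-, hp⟩, hpO⟩
      have : (⟨p, hp⟩ : {p : (E →ₗ[k] (Fin f → k)) × N // Function.Surjective p.1}) ∈
        Subtype.val ⁻¹' O := hpO
      rw [h] at this
      exact ⟨hp, this⟩
  · intro h
    refine ⟨_, h, ?_⟩
    ext p
    exact ⟨fun h => h.2, fun h => ⟨p.2, h⟩⟩

theorem isPreirreducible_gr [Infinite k] :
    IsPreirreducible (Set.univ : Set (Module.Grassmannian k E f)) := by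
  rintro U W hU hW ⟨Z, -, hZ⟩ ⟨Z', -, hZ'⟩
  obtain ⟨g, hg, rfl⟩ := exists_eq_kerGr Z
  obtain ⟨g', hg', rfl⟩ := exists_eq_kerGr Z'
  obtain ⟨t, ⟨ht, h1⟩, _, h2⟩ := exists_line_mem (k := k) (isOpen_gr_iff.1 hU) (isOpen_gr_iff.1 hW)
    ⟨hg, hZ⟩ ⟨hg', hZ'⟩
  exact ⟨_, trivial, h1, h2⟩

end Grassmannian

/-! ### Irreducibility of the variety of pairs and of `𝒫𝒲` -/

section Locus

variable {k : Type*} [Field k]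
  {A B V : Type*} [AddCommGroup A] [Module k A] [AddCommGroup B] [Module k B]
  [AddCommGroup V] [Module k V]
  {f : ℕ} {G : Type*} [AddCommGroup G] [Module k G] {X : Set G}

theorem RegularOn.formStar {g : G → A ⊗[k] SymSq k V →ₗ[k] (Fin f → k)} (hg : RegularOn k g X) :
    RegularOn k (fun x => formStar (g x)) X :=
  (hg.map (G := A ⊗[k] V →ₗ[k] V →ₗ[k] (Fin f → k)) (formStarHom k A V (Fin f → k)) :)

theorem RegularOn.one {m : G → B →ₗ[k] A ⊗[k] V} (hm : RegularOn k m X) :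
    RegularOn k (fun x => one (m x)) X :=
  (hm.map (oneHom k A B V) :)

variable [FiniteDimensional k V]

theorem mk_mem_locusQ (hV : Module.finrank k V = 4) {g : A ⊗[k] SymSq k V →ₗ[k] (Fin f → k)}
    (hg : Function.Surjective g) {m : B →ₗ[k] A ⊗[k] V} :
    (⟨kerGr g hg, m⟩ : GrProd k (A ⊗[k] SymSq k V) f (B →ₗ[k] A ⊗[k] V)) ∈ locusQ k A B V f ↔
      Function.Surjective (formStar g) ∧ formStar g ∘ₗ m = 0 := by
  rw [← codim_Zstar_ker hV, ← mem_homStar_ker]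
  rfl

variable [FiniteDimensional k A]

theorem mem_locusPW_of_ker [FiniteDimensional k B] (hV : Module.finrank k V = 4)
    (hab : 5 * Module.finrank k A ≤ 2 * Module.finrank k B)
    {g : A ⊗[k] SymSq k V →ₗ[k] (Fin f → k)} (hg : Function.Surjective (formStar g))
    {m : B →ₗ[k] A ⊗[k] V} (hm : Zof m = LinearMap.ker g) : m ∈ locusPW k A B V f := by
  have : Nontrivial V := Module.nontrivial_of_finrank_pos (R := k) (by lia)
  exact (mem_locusPW_iff_exists hV hab).2
    ⟨g, surjective_of_formStar_surjective hg, hm.symm, hg⟩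

/-- The pairs of a surjective `g` with `g*` surjective, and of `m : B → ker g*`, form an
irreducible set. -/
theorem isPreirreducible_pairs [Infinite k] :
    @IsPreirreducible _ (zariski k ((A ⊗[k] SymSq k V →ₗ[k] (Fin f → k)) × (B →ₗ[k] A ⊗[k] V)))
      {p | Function.Surjective (formStar p.1) ∧ formStar p.1 ∘ₗ p.2 = 0} := by
  let : TopologicalSpace ((A ⊗[k] SymSq k V →ₗ[k] (Fin f → k)) × (B →ₗ[k] A ⊗[k] V)) :=
    zariski k _
  have : ZariskiSpace k ((A ⊗[k] SymSq k V →ₗ[k] (Fin f → k)) × (B →ₗ[k] A ⊗[k] V)) := ⟨rfl⟩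
  refine isPreirreducible_of_forall_pair ?_
  rintro p ⟨hp, hp'⟩ q ⟨hq, hq'⟩
  -- With a common complement for the two kernels, both pairs lie in the image of one open set `X`
  -- of the ambient affine space under the regular map that projects `m` into `ker g*`. This map
  -- fixes the pairs with `g* ∘ m = 0`.
  obtain ⟨s, hsp, hsq⟩ := exists_isUnit_comp_and hp hq
  have hreg (X : Set ((A ⊗[k] SymSq k V →ₗ[k] (Fin f → k)) × (B →ₗ[k] A ⊗[k] V))) :
      RegularOn k (fun p => formStar p.1) X :=
    (regularOn_fst X).formStar
  set X := {p : (A ⊗[k] SymSq k V →ₗ[k] (Fin f → k)) × (B →ₗ[k] A ⊗[k] V) |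
    p ∈ Set.univ ∧ IsUnit (formStar p.1 ∘ₗ s : Module.End k (V →ₗ[k] (Fin f → k)))} with hX
  have hXo : IsOpen X :=
    isOpen_setOf_isUnit isOpen_univ ((hreg _).linearMap_comp (RegularOn.const s _))
  have hr : RegularOn k (fun p => (p.1, projKer s (formStar p.1) ∘ₗ p.2)) X :=
    (regularOn_fst X).prodMk
      (((hreg X).projKer fun x hx => hx.2).linearMap_comp (regularOn_snd X))
  refine ⟨_, ?_, (isPreirreducible_of_isOpen k hXo).image _ hr.continuousOn,
    ⟨p, ⟨trivial, hsp⟩, ?_⟩, ⟨q, ⟨trivial, hsq⟩, ?_⟩⟩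
  · rintro _ ⟨x, hx, rfl⟩
    refine ⟨surjective_of_isUnit_comp hx.2, ?_⟩
    rw [← LinearMap.comp_assoc, comp_projKer hx.2, LinearMap.zero_comp]
  · exact Prod.ext rfl (projKer_comp_of_comp_eq_zero hp')
  · exact Prod.ext rfl (projKer_comp_of_comp_eq_zero hq')

theorem isPreirreducible_locusQ [Infinite k] (hV : Module.finrank k V = 4) :
    IsPreirreducible (locusQ k A B V f) := by
  have : Nontrivial V := Module.nontrivial_of_finrank_pos (R := k) (by lia)
  rintro U W hU hW ⟨⟨Z, m⟩, hZ, hZU⟩ ⟨⟨Z', m'⟩, hZ', hZW⟩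
  obtain ⟨g, hg, rfl⟩ := exists_eq_kerGr Z
  obtain ⟨g', hg', rfl⟩ := exists_eq_kerGr Z'
  obtain ⟨p, hp, ⟨h1, h2⟩, _, h3⟩ := isPreirreducible_pairs _ _ (isOpen_grProd_iff.1 hU)
    (isOpen_grProd_iff.1 hW) ⟨(g, m), (mk_mem_locusQ hV hg).1 hZ, hg, hZU⟩
    ⟨(g', m'), (mk_mem_locusQ hV hg').1 hZ', hg', hZW⟩
  exact ⟨_, (mk_mem_locusQ hV h1).2 hp, h2, h3⟩

/-- The open set of the pairs `(Z, m)` such that `m(1)` has rank at least `dim Z`. -/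
theorem isOpen_setOf_rank [FiniteDimensional k B] :
    IsOpen {p : GrProd k (A ⊗[k] SymSq k V) f (B →ₗ[k] A ⊗[k] V) |
      10 * Module.finrank k A - f ≤ Module.finrank k (LinearMap.range (one p.pt))} := by
  rw [isOpen_grProd_iff]
  let : TopologicalSpace ((A ⊗[k] SymSq k V →ₗ[k] (Fin f → k)) × (B →ₗ[k] A ⊗[k] V)) :=
    zariski k _
  have : ZariskiSpace k ((A ⊗[k] SymSq k V →ₗ[k] (Fin f → k)) × (B →ₗ[k] A ⊗[k] V)) := ⟨rfl⟩
  have h1 := isOpen_setOf_surjective (k := k)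
    (isOpen_univ (X := (A ⊗[k] SymSq k V →ₗ[k] (Fin f → k)) × (B →ₗ[k] A ⊗[k] V)))
    (regularOn_fst _)
  have h2 := isOpen_setOf_le_finrank_range h1
    (regularOn_snd _).one (10 * Module.finrank k A - f)
  convert h2 using 1
  ext p
  exact ⟨fun ⟨h, h'⟩ => ⟨⟨trivial, h⟩, h'⟩, fun ⟨⟨_, h⟩, h'⟩ => ⟨h, h'⟩⟩

theorem isOpen_setOf_pt_mem {U : Set (B →ₗ[k] A ⊗[k] V)} (hU : IsOpen U) :
    IsOpen {p : GrProd k (A ⊗[k] SymSq k V) f (B →ₗ[k] A ⊗[k] V) | p.pt ∈ U} := by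
  rw [isOpen_grProd_iff]
  let : TopologicalSpace ((A ⊗[k] SymSq k V →ₗ[k] (Fin f → k)) × (B →ₗ[k] A ⊗[k] V)) :=
    zariski k _
  have : ZariskiSpace k ((A ⊗[k] SymSq k V →ₗ[k] (Fin f → k)) × (B →ₗ[k] A ⊗[k] V)) := ⟨rfl⟩
  have h1 := isOpen_setOf_surjective (k := k)
    (isOpen_univ (X := (A ⊗[k] SymSq k V →ₗ[k] (Fin f → k)) × (B →ₗ[k] A ⊗[k] V)))
    (regularOn_fst _)
  have h2 : Continuous fun p : (A ⊗[k] SymSq k V →ₗ[k] (Fin f → k)) × (B →ₗ[k] A ⊗[k] V) => p.2 :=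
    continuousOn_univ.1 (regularOn_snd (k := k) _).continuousOn
  convert h1.inter (hU.preimage h2) using 1
  ext p
  exact ⟨fun ⟨h, h'⟩ => ⟨⟨trivial, h⟩, h'⟩, fun ⟨⟨_, h⟩, h'⟩ => ⟨h, h'⟩⟩

/-- On the open set of the pairs where the rank of `m(1)` is maximal, `Im m(1) = Z`. -/
theorem Zof_eq_of_mem_locusQ [FiniteDimensional k B] (hV : Module.finrank k V = 4)
    (hab : 5 * Module.finrank k A ≤ 2 * Module.finrank k B)
    {p : GrProd k (A ⊗[k] SymSq k V) f (B →ₗ[k] A ⊗[k] V)} (hp : p ∈ locusQ k A B V f)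
    (hr : 10 * Module.finrank k A - f ≤ Module.finrank k (LinearMap.range (one p.pt))) :
    Zof p.pt = p.sub.toSubmodule ∧ p.pt ∈ locusPW k A B V f := by
  obtain ⟨Z, m⟩ := p
  obtain ⟨g, hg, rfl⟩ := exists_eq_kerGr Z
  obtain ⟨h1, h2⟩ := (mk_mem_locusQ hV hg).1 hp
  have := Zof_eq_ker hV hg h2 hr
  exact ⟨this, mem_locusPW_of_ker hV hab h1 this⟩

theorem exists_mem_locusQ [FiniteDimensional k B] (hV : Module.finrank k V = 4)
    (hab : 5 * Module.finrank k A ≤ 2 * Module.finrank k B) {m : B →ₗ[k] A ⊗[k] V}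
    (hm : m ∈ locusPW k A B V f) :
    ∃ Z : Module.Grassmannian k (A ⊗[k] SymSq k V) f, Z.toSubmodule = Zof m ∧
      (⟨Z, m⟩ : GrProd k _ f _) ∈ locusQ k A B V f ∧
      10 * Module.finrank k A - f ≤ Module.finrank k (LinearMap.range (one m)) := by
  obtain ⟨g, hg, hgm, hgs⟩ := (mem_locusPW_iff_exists hV hab).1 hm
  exact ⟨kerGr g hg, hgm, (mk_mem_locusQ hV hg).2 ⟨hgs, Zof_le_ker.1 hgm.ge⟩,
    finrank_range_one_of_Zof_eq_ker hV hg hgm.symm⟩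

/-- `𝒫𝒲` is the continuous image, under `(Z, m) ↦ m`, of the open part of the irreducible `𝒬` where
`m(1)` has rank at least `10a - f`. -/
theorem isPreirreducible_locusPW [FiniteDimensional k B] [Infinite k] (hV : Module.finrank k V = 4)
    (hab : 5 * Module.finrank k A ≤ 2 * Module.finrank k B) :
    IsPreirreducible (locusPW k A B V f) := by
  rintro U W hU hW ⟨m, hm, hmU⟩ ⟨m', hm', hmW⟩
  obtain ⟨Z, -, hZ, hr⟩ := exists_mem_locusQ hV hab hm
  obtain ⟨Z', -, hZ', hr'⟩ := exists_mem_locusQ hV hab hm'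
  obtain ⟨p, ⟨hp, hpr⟩, h1, h2⟩ := isPreirreducible_inter_isOpen (isPreirreducible_locusQ hV)
    isOpen_setOf_rank _ _ (isOpen_setOf_pt_mem hU) (isOpen_setOf_pt_mem hW)
    ⟨_, ⟨hZ, hr⟩, hmU⟩ ⟨_, ⟨hZ', hr'⟩, hmW⟩
  exact ⟨p.pt, (Zof_eq_of_mem_locusQ hV hab hp hpr).2, h1, h2⟩

end Locus

/-! ### Regular dependence of `Z_m` on `m`, and generic properties -/

section LocalForm

variable {k : Type*} [Field k]
  {A B V : Type*} [AddCommGroup A] [Module k A] [AddCommGroup B] [Module k B]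
  [AddCommGroup V] [Module k V] {f : ℕ}
  [FiniteDimensional k A] [FiniteDimensional k V]

/-- Normalization by `j` removes the `GL_f` ambiguity: the kernel of `g` and the image of `j` span
`E`, and the two maps agree on both. -/
theorem eq_of_ker_le_of_comp_eq_id {E F : Type*} [AddCommGroup E] [Module k E] [AddCommGroup F]
    [Module k F] {g g' : E →ₗ[k] F} {j : F →ₗ[k] E} (hg : g ∘ₗ j = LinearMap.id)
    (hg' : g' ∘ₗ j = LinearMap.id) (h : LinearMap.ker g ≤ LinearMap.ker g') : g' = g := by
  ext x
  have h1 : x - j (g x) ∈ LinearMap.ker g := by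
    have := LinearMap.congr_fun hg (g x)
    simp only [LinearMap.comp_apply, LinearMap.id_apply] at this
    simp [this]
  have h2 := LinearMap.congr_fun hg' (g x)
  simp only [LinearMap.comp_apply, LinearMap.id_apply] at h2
  have h3 := h h1
  rw [LinearMap.mem_ker, map_sub, h2, sub_eq_zero] at h3
  exact h3

/-- If `Z_{m₀} = ker g₀`, then for `m` close to `m₀` the image of `m(1)` contains the kernel of a
linear map depending regularly on `m`, equal to `g₀` at `m₀` and normalized by a section of `g₀`. -/
theorem exists_local_form {m₀ : B →ₗ[k] A ⊗[k] V} {g₀ : A ⊗[k] SymSq k V →ₗ[k] (Fin f → k)}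
    (hker : LinearMap.ker g₀ = Zof m₀) {j : (Fin f → k) →ₗ[k] A ⊗[k] SymSq k V}
    (hj : g₀ ∘ₗ j = LinearMap.id) :
    ∃ (U : Set (B →ₗ[k] A ⊗[k] V))
      (γ : (B →ₗ[k] A ⊗[k] V) → A ⊗[k] SymSq k V →ₗ[k] (Fin f → k)),
      IsOpen U ∧ m₀ ∈ U ∧ RegularOn k γ U ∧ γ m₀ = g₀ ∧
        ∀ m ∈ U, γ m ∘ₗ j = LinearMap.id ∧ LinearMap.ker (γ m) ≤ Zof m := by
  have hj' (y) : g₀ (j y) = y := LinearMap.congr_fun hj y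
  let π : Module.End k (A ⊗[k] SymSq k V) := LinearMap.id - j ∘ₗ g₀
  have hπj : π ∘ₗ j = 0 := by
    ext x
    simp [π, hj']
  have hππ : π ∘ₗ π = π := by
    ext x
    simp [π, hj']
  obtain ⟨c, hc⟩ : ∃ c : A ⊗[k] SymSq k V →ₗ[k] B ⊗[k] V, one m₀ ∘ₗ c = π := by
    have hmem (x) : π x ∈ LinearMap.range (one m₀) := by
      change π x ∈ Zof m₀
      rw [← hker]
      simp [π, hj']
    obtain ⟨c, hc⟩ := Module.projective_lifting_property (one m₀).rangeRestrict
      (π.codRestrict _ hmem) (LinearMap.surjective_rangeRestrict _)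
    refine ⟨c, LinearMap.ext fun x => ?_⟩
    exact congrArg Subtype.val (LinearMap.congr_fun hc x)
  -- `L m` moves `Z_{m₀}` into `Z_m` and fixes the complement `j(k^f)`, and `L m₀` is the identity.
  -- Where `L m` is invertible, `γ m = g₀ ∘ (L m)⁻¹` has kernel `L m (Z_{m₀}) ⊆ Z_m`.
  let L (m : B →ₗ[k] A ⊗[k] V) : Module.End k (A ⊗[k] SymSq k V) := one m ∘ₗ (c ∘ₗ π) + j ∘ₗ g₀
  have hL₀ : L m₀ = 1 := by
    simp only [L]
    rw [← LinearMap.comp_assoc, hc, hππ]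
    ext x
    simp [π]
  have hLreg (X) : RegularOn k L X :=
    ((regularOn_id X).one.map (LinearMap.lcomp k _ (c ∘ₗ π))).add
      (RegularOn.const _ X)
  refine ⟨{m | m ∈ Set.univ ∧ IsUnit (L m)}, fun m => g₀ ∘ₗ Ring.inverse (L m),
    isOpen_setOf_isUnit isOpen_univ (hLreg _), ⟨trivial, hL₀ ▸ isUnit_one⟩,
    (RegularOn.const g₀ _).linearMap_comp ((hLreg _).inverse fun m hm => hm.2), ?_, ?_⟩
  · simp only [hL₀, Ring.inverse_one]
    rfl
  · rintro m ⟨-, hm⟩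
    constructor
    · have h1 : L m ∘ₗ j = j := by
        ext x
        have := LinearMap.congr_fun hπj (Pi.single x 1)
        simp only [LinearMap.comp_apply, LinearMap.zero_apply] at this
        simp [L, this, hj']
      have h2 : Ring.inverse (L m) ∘ₗ j = j := by
        conv_lhs => rw [← h1, ← LinearMap.comp_assoc]
        rw [← Module.End.mul_eq_comp, Ring.inverse_mul_cancel _ hm]
        rfl
      rw [LinearMap.comp_assoc, h2, hj]
    · intro x hx
      have hx' : x = L m (Ring.inverse (L m) x) := by
        rw [← Module.End.mul_apply, Ring.mul_inverse_cancel _ hm, Module.End.one_apply]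
      rw [LinearMap.mem_ker, LinearMap.comp_apply] at hx
      rw [hx']
      simp only [L, LinearMap.add_apply, LinearMap.comp_apply, hx, map_zero, add_zero]
      exact ⟨_, rfl⟩

theorem surjective_of_comp_eq_id {E F : Type*} [AddCommGroup E] [Module k E] [AddCommGroup F]
    [Module k F] {g : E →ₗ[k] F} {j : F →ₗ[k] E} (hg : g ∘ₗ j = LinearMap.id) :
    Function.Surjective g :=
  fun y => ⟨j y, LinearMap.congr_fun hg y⟩

theorem ker_eq_of_le_codim {E : Type*} [AddCommGroup E] [Module k E] [FiniteDimensional k E]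
    {g : E →ₗ[k] (Fin f → k)} (hg : Function.Surjective g) {Z : Submodule k E}
    (hZ : LinearMap.ker g ≤ Z) (hf : f ≤ codim k Z) : LinearMap.ker g = Z := by
  refine Submodule.eq_of_le_of_finrank_le hZ ?_
  have h1 := finrank_add_codim (LinearMap.ker g)
  have h2 := finrank_add_codim Z
  rw [codim_ker_of_surjective hg] at h1
  lia

variable [FiniteDimensional k B]

/-- `𝒫𝒲` is open in `𝒲`. -/
theorem exists_isOpen_locusPW (hV : Module.finrank k V = 4)
    (hab : 5 * Module.finrank k A ≤ 2 * Module.finrank k B) :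
    ∃ U : Set (B →ₗ[k] A ⊗[k] V), IsOpen U ∧ locusPW k A B V f = locusW k A B V f ∩ U := by
  refine ⟨⋃₀ {O | IsOpen O ∧ locusW k A B V f ∩ O ⊆ locusPW k A B V f},
    isOpen_sUnion fun O hO => hO.1, Set.Subset.antisymm ?_ ?_⟩
  · intro m hm
    obtain ⟨g, hg, hgm, hgs⟩ := (mem_locusPW_iff_exists hV hab).1 hm
    obtain ⟨j, hj⟩ := exists_section hg
    obtain ⟨U, γ, hU, hmU, hγ, hγm, h⟩ := exists_local_form hgm hj
    -- The neighbourhood is the locus where `(γ m)*` is surjective. On `𝒲` the codimension of `Z_m`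
    -- is at least `f`, which forces `Z_m = ker (γ m)`.
    refine ⟨hm.1, _, ⟨isOpen_setOf_surjective hU hγ.formStar, ?_⟩, hmU, by rwa [hγm]⟩
    rintro m' ⟨hm', hm'U, hs⟩
    refine mem_locusPW_of_ker hV hab hs ?_
    exact (ker_eq_of_le_codim (surjective_of_comp_eq_id (h m' hm'U).1) (h m' hm'U).2
      ((mem_locusW hV hab).1 hm')).symm
  · rintro m ⟨hm, O, ⟨-, hO⟩, hmO⟩
    exact hO ⟨hm, hmO⟩

/-- A property of pairs holds for the generic `(Z_m, m)` with `m` in `𝒫𝒲` if and only if it holds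
for the generic pair `(Z, m)` with `m : B → Z*`. -/
theorem generically_locusPW_iff [Infinite k] (hV : Module.finrank k V = 4)
    (hab : 5 * Module.finrank k A ≤ 2 * Module.finrank k B)
    (hne : (locusPW k A B V f).Nonempty)
    (P : Submodule k (A ⊗[k] SymSq k V) → (B →ₗ[k] A ⊗[k] V) → Prop) :
    Generically (locusPW k A B V f) (fun m => P (Zof m) m) ↔
      Generically (locusQ k A B V f) (fun p => P p.sub.toSubmodule p.pt) := by
  constructor
  · rintro ⟨U, hU, ⟨m, hm, hmU⟩, h⟩
    obtain ⟨Z, -, hZ, hr⟩ := exists_mem_locusQ hV hab hm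
    refine ⟨_, (isOpen_setOf_pt_mem hU).inter isOpen_setOf_rank, ⟨⟨Z, m⟩, hZ, hmU, hr⟩, ?_⟩
    rintro p ⟨hp, hpU, hpr⟩
    obtain ⟨h1, h2⟩ := Zof_eq_of_mem_locusQ hV hab hp hpr
    rw [← h1]
    exact h _ ⟨h2, hpU⟩
  · rintro ⟨U, hU, ⟨p, hp, hpU⟩, h⟩
    obtain ⟨m₁, hm₁⟩ := hne
    obtain ⟨Z₁, -, hZ₁, hr₁⟩ := exists_mem_locusQ hV hab hm₁
    -- Irreducibility of `𝒬` supplies a pair in `U` that also comes from a point `m` of `𝒫𝒲`. Near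
    -- `m` the regular map `m' ↦ (γ m', m')` lifts `m' ↦ (Z_{m'}, m')` on `𝒫𝒲`, so `U` can be pulled
    -- back to an open set.
    obtain ⟨⟨Z, m⟩, hq, hqU, hqr⟩ := isPreirreducible_locusQ hV U _ hU isOpen_setOf_rank
      ⟨p, hp, hpU⟩ ⟨_, hZ₁, hr₁⟩
    obtain ⟨g, hg, rfl⟩ := exists_eq_kerGr Z
    obtain ⟨hmZ, hm⟩ := Zof_eq_of_mem_locusQ hV hab hq hqr
    obtain ⟨j, hj⟩ := exists_section hg
    obtain ⟨W, γ, hW, hmW, hγ, hγm, hWγ⟩ := exists_local_form (m₀ := m) (g₀ := g) hmZ.symm hj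
    let : TopologicalSpace ((A ⊗[k] SymSq k V →ₗ[k] (Fin f → k)) × (B →ₗ[k] A ⊗[k] V)) :=
      zariski k _
    have : ZariskiSpace k ((A ⊗[k] SymSq k V →ₗ[k] (Fin f → k)) × (B →ₗ[k] A ⊗[k] V)) := ⟨rfl⟩
    have hc : ContinuousOn (fun m => (γ m, m)) W :=
      RegularOn.continuousOn (k := k) (hγ.prodMk (regularOn_id W))
    refine ⟨_, hc.isOpen_inter_preimage hW (isOpen_grProd_iff.1 hU),
      ⟨m, hm, hmW, ?_⟩, ?_⟩
    · rw [Set.mem_preimage, hγm]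
      exact ⟨hg, hqU⟩
    · rintro m' ⟨hm', hm'W, hs, hm'U⟩
      have hk : LinearMap.ker (γ m') = Zof m' :=
        ker_eq_of_le_codim hs (hWγ m' hm'W).2 ((mem_locusW hV hab).1 hm'.1)
      rw [← hk]
      refine h _ ⟨(mk_mem_locusQ hV hs).2 ⟨?_, Zof_le_ker.1 hk.ge⟩, hm'U⟩
      rw [← codim_Zstar_ker hV]
      change codim k (Zstar (LinearMap.ker (γ m'))) = _
      rw [hk]
      exact hm'.2.2

theorem isOpen_setOf_formStar_surjective :
    IsOpen {g : A ⊗[k] SymSq k V →ₗ[k] (Fin f → k) |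
      Function.Surjective g ∧ Function.Surjective (formStar g)} := by
  have h1 := isOpen_setOf_surjective (k := k)
    (isOpen_univ (X := A ⊗[k] SymSq k V →ₗ[k] (Fin f → k))) (regularOn_id _)
  have h2 := isOpen_setOf_surjective h1 (regularOn_id _).formStar
  simpa using h2

theorem generically_codim_Zstar (hV : Module.finrank k V = 4)
    (hab : 5 * Module.finrank k A ≤ 2 * Module.finrank k B)
    (hne : (locusPW k A B V f).Nonempty) :
    Generically (Set.univ : Set (Module.Grassmannian k (A ⊗[k] SymSq k V) f))
      (fun Z => codim k (Zstar Z.toSubmodule) = 4 * f) := by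
  obtain ⟨m, hm⟩ := hne
  obtain ⟨Z, -, hZ, -⟩ := exists_mem_locusQ hV hab hm
  refine ⟨{Z | codim k (Zstar Z.toSubmodule) = 4 * f}, ?_, ⟨Z, trivial, hZ.1⟩, fun Z hZ => hZ.2⟩
  rw [isOpen_gr_iff]
  convert isOpen_setOf_formStar_surjective (k := k) (A := A) (V := V) (f := f) using 1
  ext g
  refine ⟨fun ⟨hg, h⟩ => ⟨hg, (codim_Zstar_ker hV g).1 h⟩,
    fun ⟨hg, h⟩ => ⟨hg, (codim_Zstar_ker hV g).2 h⟩⟩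

/-- For the generic `Z`, the generic `m : B → Z*` is in `𝒫𝒲` and satisfies `Im m(1) = Z`. -/
theorem generically_homStar (hV : Module.finrank k V = 4)
    (hab : 5 * Module.finrank k A ≤ 2 * Module.finrank k B)
    (hne : (locusPW k A B V f).Nonempty) :
    Generically (Set.univ : Set (Module.Grassmannian k (A ⊗[k] SymSq k V) f))
      (fun Z => Generically (homStar B Z.toSubmodule)
        (fun m => m ∈ locusPW k A B V f ∧ Zof m = Z.toSubmodule)) := by
  obtain ⟨m, hm⟩ := hne
  obtain ⟨Z, -, hZ, hr⟩ := exists_mem_locusQ hV hab hm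
  refine ⟨{Z | ∃ m : B →ₗ[k] A ⊗[k] V, (⟨Z, m⟩ : GrProd k _ f _) ∈ locusQ k A B V f ∧
    10 * Module.finrank k A - f ≤ Module.finrank k (LinearMap.range (one m))}, ?_,
    ⟨Z, trivial, m, hZ, hr⟩, ?_⟩
  · rw [isOpen_gr_iff, isOpen_iff_forall_mem_open]
    rintro g ⟨hg, m, hm, hr⟩
    obtain ⟨hgs, hgm⟩ := (mk_mem_locusQ hV hg).1 hm
    -- For openness in `Z`, the given `m` is deformed along with `g'`: its projection into `ker g'*`
    -- depends regularly on `g'` and equals `m` at `g`, so the rank bound persists nearby.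
    obtain ⟨s, hs⟩ := exists_section hgs
    have h1 : IsOpen {g : A ⊗[k] SymSq k V →ₗ[k] (Fin f → k) |
        (Function.Surjective g ∧ Function.Surjective (formStar g)) ∧
          IsUnit (formStar g ∘ₗ s : Module.End k (V →ₗ[k] (Fin f → k)))} :=
      isOpen_setOf_isUnit isOpen_setOf_formStar_surjective
        ((regularOn_id _).formStar.linearMap_comp (RegularOn.const s _))
    have h2 := isOpen_setOf_le_finrank_range h1
      ((RegularOn.projKer (regularOn_id _).formStar fun x hx =>
        hx.2).linearMap_comp (RegularOn.const m _)).one (10 * Module.finrank k A - f)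
    refine ⟨_, ?_, h2, ⟨⟨hg, hgs⟩, ?_⟩, ?_⟩
    · rintro g' ⟨⟨⟨hg', hgs'⟩, hu⟩, hr'⟩
      refine ⟨hg', projKer s (formStar g') ∘ₗ m, (mk_mem_locusQ hV hg').2 ⟨hgs', ?_⟩, hr'⟩
      rw [← LinearMap.comp_assoc, comp_projKer hu, LinearMap.zero_comp]
    · change IsUnit (formStar g ∘ₗ s)
      rw [hs]
      exact isUnit_one
    · change _ ≤ Module.finrank k (LinearMap.range (one (projKer s (formStar g) ∘ₗ m)))
      rw [projKer_comp_of_comp_eq_zero hgm]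
      exact hr
  · rintro Z ⟨-, m, hm, hr⟩
    have ho := isOpen_setOf_le_finrank_range (k := k)
      (isOpen_univ (X := B →ₗ[k] A ⊗[k] V)) (regularOn_id _).one
      (10 * Module.finrank k A - f)
    refine ⟨_, ho, ⟨m, hm.2, trivial, hr⟩, ?_⟩
    rintro m' ⟨hm', -, hr'⟩
    exact (Zof_eq_of_mem_locusQ hV hab (p := ⟨Z, m'⟩) ⟨hm.1, hm'⟩ hr').symm

end LocalForm

/-! ### Charts and the codimension of `𝒫𝒲` -/

section Dimension

theorem topologicalKrullDim_eq_of_invOn {X Y : Type*} [TopologicalSpace X] [TopologicalSpace Y]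
    {S : Set X} {T : Set Y} {φ : X → Y} {ψ : Y → X} (hφ : ContinuousOn φ S)
    (hψ : ContinuousOn ψ T) (hST : Set.MapsTo φ S T) (hTS : Set.MapsTo ψ T S)
    (h : Set.InvOn ψ φ S T) : topologicalKrullDim S = topologicalKrullDim T := by
  let e : S ≃ₜ T :=
    { toFun := hST.restrict φ S T
      invFun := hTS.restrict ψ T S
      left_inv := fun x => Subtype.ext (h.1 x.2)
      right_inv := fun y => Subtype.ext (h.2 y.2)
      continuous_toFun := hφ.mapsToRestrict hST
      continuous_invFun := hψ.mapsToRestrict hTS }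
  exact IsHomeomorph.topologicalKrullDim_eq e e.isHomeomorph

theorem topologicalKrullDim_eq_of_forall_mem_open {X : Type*} [TopologicalSpace X] {S : Set X}
    {d : ℕ} (hne : S.Nonempty)
    (h : ∀ x ∈ S, ∃ U : Set X, IsOpen U ∧ x ∈ U ∧ topologicalKrullDim ↥(S ∩ U) = d) :
    topologicalKrullDim S = d := by
  refine le_antisymm (topologicalKrullDim_le_of_forall_mem_open fun x => ?_) ?_
  · obtain ⟨U, hU, hxU, hd⟩ := h x x.2
    refine ⟨Subtype.val ⁻¹' U, hU.preimage continuous_subtype_val, hxU, ?_⟩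
    rw [← hd]
    let i : (Subtype.val ⁻¹' U : Set S) → ↥(S ∩ U) := fun y => ⟨y.1.1, y.1.2, y.2⟩
    have hi : Topology.IsInducing i := by
      refine Topology.IsInducing.of_comp ?_ continuous_subtype_val
        ((Topology.IsInducing.subtypeVal (t := S)).comp
          (Topology.IsInducing.subtypeVal (t := (Subtype.val ⁻¹' U : Set S))) :)
      exact (continuous_subtype_val.comp continuous_subtype_val).subtype_mk _
    exact hi.topologicalKrullDim_le
  · obtain ⟨x, hx⟩ := hne
    obtain ⟨U, -, -, hd⟩ := h x hx
    rw [← hd]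
    have hSU : S ∩ U ⊆ S := Set.inter_subset_left
    exact (Topology.IsEmbedding.inclusion hSU).isInducing.topologicalKrullDim_le

variable {k : Type*} [Field k]
  {A B V : Type*} [AddCommGroup A] [Module k A] [AddCommGroup B] [Module k B]
  [AddCommGroup V] [Module k V] {f : ℕ}
  [FiniteDimensional k A] [FiniteDimensional k B] [FiniteDimensional k V]

/-- Around each of its points, `𝒫𝒲` is homeomorphic to an open subset of an affine space. -/
theorem exists_chart_locusPW [Infinite k] (hV : Module.finrank k V = 4)
    (hab : 5 * Module.finrank k A ≤ 2 * Module.finrank k B) {m₀ : B →ₗ[k] A ⊗[k] V}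
    (hm₀ : m₀ ∈ locusPW k A B V f) :
    ∃ (U : Set (B →ₗ[k] A ⊗[k] V)) (d : ℕ), IsOpen U ∧ m₀ ∈ U ∧
      topologicalKrullDim ↥(locusPW k A B V f ∩ U) = d ∧
      d + f * f + 4 * Module.finrank k B * f =
        10 * Module.finrank k A * f + 4 * Module.finrank k A * Module.finrank k B := by
  obtain ⟨g₀, hg₀, hgm₀, hgs₀⟩ := (mem_locusPW_iff_exists hV hab).1 hm₀
  obtain ⟨j, hj⟩ := exists_section hg₀
  obtain ⟨s, hs⟩ := exists_section hgs₀
  obtain ⟨W, γ, hW, hmW, hγ, hγm, hWγ⟩ := exists_local_form hgm₀ hj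
  have hj' (y) : g₀ (j y) = y := LinearMap.congr_fun hj y
  have hs' (y) : formStar g₀ (s y) = y := LinearMap.congr_fun hs y
  let Z := LinearMap.ker g₀
  let K := LinearMap.ker (formStar g₀)
  let π : A ⊗[k] SymSq k V →ₗ[k] Z := (LinearMap.id - j ∘ₗ g₀).codRestrict Z fun x => by
    simp [Z, hj']
  have hπj : π ∘ₗ j = 0 := by
    refine LinearMap.ext fun x => Subtype.ext ?_
    simp [π, hj']
  have hπZ : π ∘ₗ Z.subtype = LinearMap.id := by
    refine LinearMap.ext fun x => Subtype.ext ?_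
    have : g₀ x = 0 := x.2
    simp [π, this]
  let κ : A ⊗[k] V →ₗ[k] K := (LinearMap.id - s ∘ₗ formStar g₀).codRestrict K fun x => by
    simp [K, hs']
  let : TopologicalSpace ((Z →ₗ[k] (Fin f → k)) × (B →ₗ[k] K)) := zariski k _
  have : ZariskiSpace k ((Z →ₗ[k] (Fin f → k)) × (B →ₗ[k] K)) := ⟨rfl⟩
  let U := {m | m ∈ W ∧ IsUnit (formStar (γ m) ∘ₗ s : Module.End k (V →ₗ[k] (Fin f → k)))}
  have hU : IsOpen U :=
    isOpen_setOf_isUnit hW (hγ.formStar.linearMap_comp (RegularOn.const s W))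
  have hmU : m₀ ∈ U := by
    refine ⟨hmW, ?_⟩
    rw [hγm, hs]
    exact isUnit_one
  -- The first coordinate is the usual Grassmannian chart, since a map normalized by `j` is
  -- determined by its restriction to `Z`. The second compares `ker (γ m)*` with `K = ker g₀*` by
  -- projecting along the image of `s`.
  let φ (m : B →ₗ[k] A ⊗[k] V) : (Z →ₗ[k] (Fin f → k)) × (B →ₗ[k] K) :=
    ((γ m - g₀) ∘ₗ Z.subtype, κ ∘ₗ m)
  have hφ : RegularOn k φ U :=
    (((hγ.mono fun m hm => hm.1).sub (RegularOn.const g₀ U)).linearMap_comp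
      (RegularOn.const Z.subtype U)).prodMk
      ((RegularOn.const κ U).linearMap_comp (regularOn_id U))
  have hform (X : Set ((Z →ₗ[k] (Fin f → k)) × (B →ₗ[k] K))) :
      RegularOn k (fun p => formStar (g₀ + p.1 ∘ₗ π)) X :=
    ((RegularOn.const g₀ X).add ((regularOn_fst X).linearMap_comp (RegularOn.const π X))).formStar
  let X := {p : (Z →ₗ[k] (Fin f → k)) × (B →ₗ[k] K) | p ∈ Set.univ ∧ IsUnit (formStar
    (g₀ + p.1 ∘ₗ π) ∘ₗ s : Module.End k (V →ₗ[k] (Fin f → k)))}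
  have hX : IsOpen X :=
    isOpen_setOf_isUnit isOpen_univ ((hform _).linearMap_comp (RegularOn.const s _))
  let ψ (p : (Z →ₗ[k] (Fin f → k)) × (B →ₗ[k] K)) : B →ₗ[k] A ⊗[k] V :=
    projKer s (formStar (g₀ + p.1 ∘ₗ π)) ∘ₗ (K.subtype ∘ₗ p.2)
  have hψ : RegularOn k ψ X :=
    ((hform X).projKer fun p hp => hp.2).linearMap_comp
      ((regularOn_snd X).map (LinearMap.compRight k K.subtype))
  -- `ψ` rebuilds `g = g₀ + p.1 ∘ π` and projects `p.2` into `ker g*`. The condition `ψ p ∈ U`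
  -- ensures that `γ (ψ p)` exists; it is then `g`, because both are normalized by `j` and `ker (γ
  -- (ψ p)) ⊆ Z_{ψ p} ⊆ ker g`.
  let T := X ∩ ψ ⁻¹' U
  have hT : IsOpen T := hψ.continuousOn.isOpen_inter_preimage hX hU
  have hγP {m : B →ₗ[k] A ⊗[k] V} (hm : m ∈ W) :
      g₀ + ((γ m - g₀) ∘ₗ Z.subtype) ∘ₗ π = γ m := by
    refine LinearMap.ext fun x => ?_
    have := LinearMap.congr_fun (hWγ m hm).1 (g₀ x)
    simp only [LinearMap.comp_apply, LinearMap.id_apply] at this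
    simp [π, this, hj']
  have hleft : Set.LeftInvOn ψ φ (locusPW k A B V f ∩ U) := by
    rintro m ⟨hm, hmU⟩
    have hk : LinearMap.ker (γ m) = Zof m := ker_eq_of_le_codim
      (surjective_of_comp_eq_id (hWγ m hmU.1).1) (hWγ m hmU.1).2 ((mem_locusW hV hab).1 hm.1)
    have h0 : formStar (γ m) ∘ₗ m = 0 := Zof_le_ker.1 hk.ge
    -- `κ` changes `m` only by values in the image of `s`, which `projKer s` kills.
    have h1 : K.subtype ∘ₗ κ ∘ₗ m = m - s ∘ₗ (formStar g₀ ∘ₗ m) := by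
      ext x
      simp [κ]
    change projKer s (formStar (g₀ + ((γ m - g₀) ∘ₗ Z.subtype) ∘ₗ π)) ∘ₗ
      (K.subtype ∘ₗ κ ∘ₗ m) = m
    rw [hγP hmU.1, h1, LinearMap.comp_sub, projKer_comp_of_comp_eq_zero h0, ← LinearMap.comp_assoc,
      projKer_comp hmU.2, LinearMap.zero_comp, sub_zero]
  have hker {p : (Z →ₗ[k] (Fin f → k)) × (B →ₗ[k] K)} (hp : p ∈ T) :
      γ (ψ p) = g₀ + p.1 ∘ₗ π ∧
        Zof (ψ p) = LinearMap.ker (γ (ψ p)) := by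
    have h1 : (g₀ + p.1 ∘ₗ π) ∘ₗ j = LinearMap.id := by
      rw [LinearMap.add_comp, LinearMap.comp_assoc, hπj, LinearMap.comp_zero, add_zero, hj]
    have h2 : Zof (ψ p) ≤ LinearMap.ker (g₀ + p.1 ∘ₗ π) := by
      rw [Zof_le_ker, ← LinearMap.comp_assoc, comp_projKer hp.1.2, LinearMap.zero_comp]
    obtain ⟨h3, h4⟩ := hWγ (ψ p) hp.2.1
    have h5 := eq_of_ker_le_of_comp_eq_id h3 h1 (h4.trans h2)
    exact ⟨h5.symm, le_antisymm (h5 ▸ h2) h4⟩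
  have hright : Set.RightInvOn ψ φ T := by
    intro p hp
    refine Prod.ext ?_ (LinearMap.ext fun x => Subtype.ext ?_)
    · change (γ (ψ p) - g₀) ∘ₗ Z.subtype = p.1
      rw [(hker hp).1, add_sub_cancel_left, LinearMap.comp_assoc, hπZ, LinearMap.comp_id]
    · have h0 : formStar g₀ (p.2 x : A ⊗[k] V) = 0 := (p.2 x).2
      simp [φ, κ, ψ, projKer, hs', h0]
  have hdim := topologicalKrullDim_eq_of_invOn (hφ.continuousOn.mono Set.inter_subset_right)
    (hψ.continuousOn.mono Set.inter_subset_left)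
    (S := locusPW k A B V f ∩ U) (T := T) ?_ ?_ ⟨hleft, hright⟩
  rotate_left
  · rintro m ⟨hm, hmU⟩
    refine ⟨⟨trivial, ?_⟩, ?_⟩
    · change IsUnit (formStar (g₀ + ((γ m - g₀) ∘ₗ Z.subtype) ∘ₗ π) ∘ₗ s)
      rw [hγP hmU.1]
      exact hmU.2
    · rw [Set.mem_preimage, hleft ⟨hm, hmU⟩]
      exact hmU
  · intro p hp
    refine ⟨mem_locusPW_of_ker hV hab ?_ (hker hp).2, hp.2⟩
    exact surjective_of_isUnit_comp hp.2.2
  have hTne : T.Nonempty := by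
    refine ⟨φ m₀, ⟨trivial, ?_⟩, ?_⟩
    · change IsUnit (formStar (g₀ + ((γ m₀ - g₀) ∘ₗ Z.subtype) ∘ₗ π) ∘ₗ s)
      rw [hγP hmW]
      exact hmU.2
    · rw [Set.mem_preimage, hleft ⟨hm₀, hmU⟩]
      exact hmU
  refine ⟨U, _, hU, hmU, hdim.trans (topologicalKrullDim_of_isOpen k hT hTne), ?_⟩
  -- `dim Z = 10a - f` and `dim K = 4a - 4f`; the identities stay additive because subtraction in
  -- `ℕ` truncates.
  have e1 := finrank_add_codim Z
  rw [codim_ker_of_surjective hg₀, finrank_tensor_symSq hV] at e1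
  have e2 := (formStar g₀).finrank_range_add_finrank_ker
  rw [LinearMap.range_eq_top.2 hgs₀, finrank_top, Module.finrank_linearMap, hV,
    Module.finrank_fin_fun, Module.finrank_tensorProduct, hV] at e2
  rw [Module.finrank_prod, Module.finrank_linearMap, Module.finrank_linearMap,
    Module.finrank_fin_fun]
  change _ + Module.finrank k K = _ at e2
  rw [← e1]
  have e3 : Module.finrank k B * (4 * f) + Module.finrank k B * Module.finrank k K =
      Module.finrank k B * (Module.finrank k A * 4) := by rw [← mul_add, e2]
  linarith

theorem hasCodim_locusPW [Infinite k] (hV : Module.finrank k V = 4)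
    (hab : 5 * Module.finrank k A ≤ 2 * Module.finrank k B)
    (hne : (locusPW k A B V f).Nonempty) :
    HasCodim (locusPW k A B V f)
      (f * (4 * Module.finrank k B - 10 * Module.finrank k A + f)) := by
  obtain ⟨m, hm⟩ := hne
  obtain ⟨-, d, -, -, -, hd⟩ := exists_chart_locusPW hV hab hm
  refine ⟨d, 4 * Module.finrank k A * Module.finrank k B,
    topologicalKrullDim_eq_of_forall_mem_open ⟨m, hm⟩ fun m' hm' => ?_, ?_, ?_⟩
  · obtain ⟨U, d', hU, hmU, h, hd'⟩ := exists_chart_locusPW hV hab hm'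
    obtain rfl : d' = d := by lia
    exact ⟨U, hU, hmU, h⟩
  · have h1 := topologicalKrullDim_of_isOpen k (isOpen_univ (X := B →ₗ[k] A ⊗[k] V)) ⟨0, trivial⟩
    rw [IsHomeomorph.topologicalKrullDim_eq _
      (Homeomorph.Set.univ (B →ₗ[k] A ⊗[k] V)).isHomeomorph] at h1
    rw [h1, Module.finrank_linearMap, Module.finrank_tensorProduct, hV]
    norm_cast
    ring
  -- By `5a ≤ 2b` the difference `4b - 10a` in the codimension is not truncated.
  · obtain ⟨c, hc⟩ : ∃ c, 4 * Module.finrank k B = 10 * Module.finrank k A + c :=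
      Nat.exists_eq_add_of_le (by lia)
    rw [hc, Nat.add_sub_cancel_left]
    rw [hc] at hd
    linarith

end Dimension

end Steiner

end

theorem proposition4p1 {k : Type*} [Field k] [IsAlgClosed k] [CharZero k]
    {A B V : Type*} [AddCommGroup A] [Module k A] [FiniteDimensional k A]
    [AddCommGroup B] [Module k B] [FiniteDimensional k B]
    [AddCommGroup V] [Module k V] [FiniteDimensional k V]
    (a b f : ℕ) (hA : Module.finrank k A = a) (hB : Module.finrank k B = b)
    (hV : Module.finrank k V = 4) (hf : 1 ≤ f) (hab : 5 * a ≤ 2 * b) (haf : 5 * f < 2 * a) :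
    -- `𝒫𝒲` is open in `𝒲`
    (∃ U : Set (B →ₗ[k] A ⊗[k] V), IsOpen U ∧
      Steiner.locusPW k A B V f = Steiner.locusW k A B V f ∩ U) ∧
    -- `𝒫𝒲` is non-empty and irreducible
    (Steiner.locusPW k A B V f).Nonempty ∧
    IsIrreducible (Steiner.locusPW k A B V f) ∧
    -- `𝒫𝒲` has the expected codimension
    Steiner.HasCodim (Steiner.locusPW k A B V f) (f * (4 * b - 10 * a + f)) ∧
    -- the Grassmannian is irreducible, and `Z*` has codimension `4f` for the generic `Z`
    IsIrreducible (Set.univ :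
      Set (Module.Grassmannian k (A ⊗[k] Steiner.SymSq k V) f)) ∧
    Steiner.Generically
      (Set.univ : Set (Module.Grassmannian k (A ⊗[k] Steiner.SymSq k V) f))
      (fun Z => Steiner.codim k (Steiner.Zstar Z.toSubmodule) = 4 * f) ∧
    -- the pairs `(Z, m)` with `m : B → Z*` form an irreducible variety, and the generic matrix `μ`
    -- of `𝒫𝒲`, with the subspace `Im μ(1)`, is the generic such pair
    IsIrreducible (Steiner.locusQ k A B V f) ∧
    (∀ P : Submodule k (A ⊗[k] Steiner.SymSq k V) →
        (B →ₗ[k] A ⊗[k] V) → Prop,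
      Steiner.Generically (Steiner.locusPW k A B V f) (fun m => P (Steiner.Zof m) m) ↔
        Steiner.Generically (Steiner.locusQ k A B V f) (fun p => P p.sub.toSubmodule p.pt)) ∧
    -- for the generic pair `(Z, m)`, the image of `m(1)` is `Z`
    Steiner.Generically (Steiner.locusQ k A B V f)
      (fun p => Steiner.Zof p.pt = p.sub.toSubmodule) ∧
    -- fibrewise: for the generic `Z`, the generic `m : B → Z*` is in `𝒫𝒲`, and `Im m(1) = Z`
    Steiner.Generically
      (Set.univ : Set (Module.Grassmannian k (A ⊗[k] Steiner.SymSq k V) f))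
      (fun Z => Steiner.Generically (Steiner.homStar B Z.toSubmodule)
        (fun m => m ∈ Steiner.locusPW k A B V f ∧ Steiner.Zof m = Z.toSubmodule)) := by
  subst hA hB
  have hinf : Infinite k := inferInstance
  obtain ⟨m, g, hg, hm⟩ := Steiner.exists_of_hasDatum hV (Steiner.hasDatum (k := k) hf hab haf)
  have hmPW := Steiner.mem_locusPW_of_ker hV hab hg hm
  have hne : (Steiner.locusPW k A B V f).Nonempty := ⟨m, hmPW⟩
  obtain ⟨Z, hZm, hZ, hr⟩ := Steiner.exists_mem_locusQ hV hab hmPW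
  refine ⟨Steiner.exists_isOpen_locusPW hV hab, hne, ⟨hne, Steiner.isPreirreducible_locusPW hV hab⟩,
    Steiner.hasCodim_locusPW hV hab hne, ⟨⟨Z, trivial⟩, Steiner.isPreirreducible_gr⟩,
    Steiner.generically_codim_Zstar hV hab hne, ⟨⟨_, hZ⟩, Steiner.isPreirreducible_locusQ hV⟩,
    Steiner.generically_locusPW_iff hV hab hne, ?_, Steiner.generically_homStar hV hab hne⟩
  exact ⟨_, Steiner.isOpen_setOf_rank, ⟨_, hZ, hr⟩,
    fun p hp => (Steiner.Zof_eq_of_mem_locusQ hV hab hp.1 hp.2).1⟩
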